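/- A straight-line program (SLP) is a sequence of integers $b_0,b_1,\dots,b_m$ with $b_0=1$ and, for every $1\le i\le m$, $b_i=b_j\circ_i b_k$ for some specified indices $j,k<i$ and operation $\circ_i\in\{+,-,\times\}$; it is given as the list of its instructions $(\circ_i,j,k)$, written as a bit string, and it represents the integer $N=b_m$. Consider the following decision problems. - $\mathrm{PosSLP}$: given an SLP representing $N\in\mathbb Z$, decide whether $N>0$. - $\mathrm{Div2SLP}$: given an SLP representing $N\in\mathbb Z$ and a natural number $\ell$ in binary, decide whether $2^{\ell}$ divides $|N|$. - $\mathrm{3SoSSLP}$: given an SLP representing $N\in\mathbb Z$, decide whether there are integers $a,b,c$ with $N=a^2+b^2+c^2$. **Theorem.** $\mathrm{3SoSSLP}\in\mathrm{P}^{\{\mathrm{Div2SLP},\,\mathrm{PosSLP}\}}$. That is, $\mathrm{3SoSSLP}$ is decided in time polynomial in the length of the input by a deterministic Turing machine with oracle access to both $\mathrm{Div2SLP}$ and $\mathrm{PosSLP}$. -/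

import Mathlib

namespace SLPComplexity

/-! ### Straight-line programs -/

/-- The arithmetic operations of a division-free straight-line program. -/
inductive Op
  | add
  | sub
  | mul

/-- The operation on integers denoted by an operation symbol. -/
def Op.eval : Op → ℤ → ℤ → ℤ
  | .add, x, y => x + y
  | .sub, x, y => x - y
  | .mul, x, y => x * y

/-- An instruction `b_i = b_fst ∘ b_snd`. -/
structure Instr where
  op : Op
  fst : ℕ
  snd : ℕ

/-- A constant-free, variable-free, division-free straight-line program `(b_0, …, b_m)`: `b_0 = 1`,
and the entry of `instrs` at position `i` (counted from `0`) is the instruction that computes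
`b_(i+1)` from two of the numbers `b_0, …, b_i`. -/
structure SLP where
  instrs : List Instr
  wf : ∀ (i : ℕ) (h : i < instrs.length), instrs[i].fst ≤ i ∧ instrs[i].snd ≤ i

/-- Executing one instruction: the new number is appended to the list of numbers computed so far.
(The default value `0` is never read in a well-formed program.) -/
def execInstr (b : List ℤ) (I : Instr) : List ℤ :=
  b ++ [I.op.eval (b.getD I.fst 0) (b.getD I.snd 0)]

/-- The list `[b_0, …, b_m]` of all numbers computed by a program. -/
def SLP.values (P : SLP) : List ℤ :=
  P.instrs.foldl execInstr [1]

/-- The integer `b_m` represented by a program. -/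
def SLP.value (P : SLP) : ℤ :=
  P.values.getLastD 0

/-! ### Binary encodings -/

/-- A self-delimiting binary encoding of natural numbers: every binary digit `d` (least significant
digit first, no leading zeros) is written as `1d`, and a final `0` marks the end. -/
def encodeNat (n : ℕ) : List Bool :=
  (Nat.bits n).flatMap (fun d => [true, d]) ++ [false]

/-- Two bits for every operation symbol. -/
def encodeOp : Op → List Bool
  | .add => [false, false]
  | .sub => [false, true]
  | .mul => [true, false]

def encodeInstr (I : Instr) : List Bool :=
  encodeOp I.op ++ encodeNat I.fst ++ encodeNat I.snd

/-- The description of a straight-line program as a bit string. -/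
def SLP.encode (P : SLP) : List Bool :=
  P.instrs.flatMap encodeInstr

/-! ### The decision problems, as languages over `{0,1}` -/

/-- Given a straight-line program representing `N`, decide whether `N > 0`. -/
def PosSLP : Language Bool :=
  {w | ∃ P : SLP, w = P.encode ∧ 0 < P.value}

/-- Given a straight-line program representing `N` and a natural number `ℓ` in binary, decide
whether `2 ^ ℓ` divides `|N|`. -/
def Div2SLP : Language Bool :=
  {w | ∃ (P : SLP) (ℓ : ℕ), w = encodeNat ℓ ++ P.encode ∧ (2 : ℤ) ^ ℓ ∣ |P.value|}

/-- Given a straight-line program representing `N`, decide whether `N` is a sum of three squares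
of integers. -/
def ThreeSoSSLP : Language Bool :=
  {w | ∃ P : SLP, w = P.encode ∧ ∃ a b c : ℤ, P.value = a ^ 2 + b ^ 2 + c ^ 2}

/-! ### Deterministic oracle machines and polynomial time -/

/-- A deterministic machine with oracles from the set `𝒪` of languages: a multi-stack Turing machine
(Mathlib's `Turing.TM2` with finitely many stacks, labels and internal states) over the alphabet
`{0,1}`, in which every label may ask an oracle. If `query l = some (A, k)`, then at label `l`
the machine first learns whether the word on stack `k` (read from the top) belongs to `A`, by
updating its internal state with the answer bit through `receive`, and then runs the statement
`prog l`. A query leaves the stacks unchanged. -/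
structure OracleTM (𝒪 : Set (Language Bool)) where
  /-- the index type of the stacks -/
  K : Type
  [decEqK : DecidableEq K]
  [finK : Fintype K]
  /-- the labels of the program (the control states) -/
  Λ : Type
  [finΛ : Fintype Λ]
  /-- the internal states -/
  σ : Type
  [finσ : Fintype σ]
  /-- the stack that initially holds the input -/
  inputStack : K
  /-- the label at which the computation starts -/
  main : Λ
  /-- the internal state in which the computation starts -/
  initialState : σ
  /-- the internal states in which halting means acceptance -/
  accept : σ → Bool
  /-- the oracle call made at a label, if any: the oracle and the stack holding the question -/
  query : Λ → Option (𝒪 × K)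
  /-- how the answer bit is stored in the internal state -/
  receive : σ → Bool → σ
  /-- the program -/
  prog : Λ → Turing.TM2.Stmt (fun _ : K => Bool) Λ σ

namespace OracleTM

variable {𝒪 : Set (Language Bool)}

instance (M : OracleTM 𝒪) : DecidableEq M.K := M.decEqK

/-- Configurations: the current label (`none` if the machine has halted), the internal state and
the contents of the stacks. -/
abbrev Cfg (M : OracleTM 𝒪) : Type :=
  Turing.TM2.Cfg (fun _ : M.K => Bool) M.Λ M.σ

open Classical in
/-- The internal state after the oracle call, if any, of label `l`. -/
noncomputable def consult (M : OracleTM 𝒪) (l : M.Λ) (v : M.σ) (S : M.K → List Bool) : M.σ :=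
  match M.query l with
  | none => v
  | some (A, k) => M.receive v (decide (S k ∈ (A : Language Bool)))

/-- One step of the machine: the oracle call, if any, and the statement of the current label.
A halted machine makes no step. -/
noncomputable def step (M : OracleTM 𝒪) : M.Cfg → Option M.Cfg
  | ⟨none, _, _⟩ => none
  | ⟨some l, v, S⟩ => Turing.TM2.step M.prog ⟨some l, M.consult l v S, S⟩

/-- The initial configuration on input `w`: the word `w` is on the input stack (first letter on
top), and all the other stacks are empty. -/
def init (M : OracleTM 𝒪) (w : List Bool) : M.Cfg where
  l := some M.main
  var := M.initialState
  stk := fun k => if k = M.inputStack then w else []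

/-- On input `w` the machine halts after at most `t` steps, and it accepts iff `w ∈ L`. -/
def DecidesInTime (M : OracleTM 𝒪) (L : Language Bool) (w : List Bool) (t : ℕ) : Prop :=
  ∃ c : M.Cfg, Nonempty (StateTransition.EvalsToInTime M.step (M.init w) (some c) t) ∧
    c.l = none ∧ (M.accept c.var = true ↔ w ∈ L)

end OracleTM

/-- The class `P^𝒪` of the languages decided by a deterministic machine with oracles from `𝒪` in
time polynomial in the length of the input. -/
def PolyTimeRel (𝒪 : Set (Language Bool)) : Set (Language Bool) :=
  {L | ∃ (M : OracleTM 𝒪) (p : Polynomial ℕ),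
    ∀ w : List Bool, M.DecidesInTime L w (p.eval w.length)}

end SLPComplexity

namespace SLPComplexity

/-! ### Sums of three squares -/

section ThreeSquares

/-! For N ≠ 0 write N = 4^a y with 4 ∤ y. By Legendre's theorem (`four_pow_mul_eq_sum_three_sq_iff`)
N is a sum of three squares iff y > 0 and y is not 7 modulo 8. Both conditions are visible in the
single number 4^a (N + 4^a) = 2^(4a) (y + 1): its sign and its divisibility by 2^(4a+3) decide the
matter (`sum_three_sq_iff_of_four_pow`).

A program with m instructions has |N| ≤ 2^(2^m) (`abs_le_of_mem_values`), so a < 2^m for N ≠ 0, and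
bisection finds the binary digits of a with m questions to `Div2SLP` (`exec_search`). Repeated
squaring then appends a computation of 4^a with at most three instructions per digit
(`exec_horner`), and one question to `PosSLP`, followed if necessary by one to `Div2SLP`, settles
the extended program. Malformed inputs are recognized by asking `Div2SLP` whether 2^0 divides the
value.

The sufficiency half of Legendre's theorem goes through ternary forms: reduction shows that a
positive definite form of determinant one represents only sums of three squares
(`ternary_det_one_sum_three_sq`), while Dirichlet's theorem on primes in progressions and quadratic
reciprocity produce such a form representing y.

The machine is obtained from a structured program: `Runs` records running times, and
`Runs.decidesInTime` carries them over to the compiled oracle machine. -/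

theorem exists_abs_two_mul_add_mul_le (a b : ℤ) (ha : 0 < a) :
    ∃ k : ℤ, -a ≤ 2 * (b + k * a) ∧ 2 * (b + k * a) ≤ a := by
  refine ⟨-((2 * b + a) / (2 * a)), ?_, ?_⟩
  · have := Int.mul_ediv_add_emod (2 * b + a) (2 * a)
    have := Int.emod_nonneg (2 * b + a) (show 2 * a ≠ 0 by omega)
    linarith
  · have := Int.mul_ediv_add_emod (2 * b + a) (2 * a)
    have := Int.emod_lt_of_pos (2 * b + a) (show 0 < 2 * a by omega)
    linarith

/-- A positive definite binary form of determinant `D` properly represents some `A'` with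
`3 A' ^ 2 ≤ 4 D`. -/
theorem exists_binary_reduction (n : ℕ) : ∀ A B C : ℤ, A.toNat = n → 0 < A → 0 < A * C - B ^ 2 →
    ∃ p q r s : ℤ, p * s - q * r = 1 ∧ 0 < A * p ^ 2 + 2 * B * p * r + C * r ^ 2 ∧
      3 * (A * p ^ 2 + 2 * B * p * r + C * r ^ 2) ^ 2 ≤ 4 * (A * C - B ^ 2) := by
  induction n using Nat.strong_induction_on with
  | _ n ih =>
    intro A B C hn hA hD
    by_cases h : 3 * A ^ 2 ≤ 4 * (A * C - B ^ 2)
    · exact ⟨1, 0, 0, 1, by norm_num, by simpa using hA, by simpa using h⟩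
    -- Translating by k makes the middle coefficient at most A / 2 in absolute value. The new last
    -- coefficient C' then has A C' = D + (B + k A)² < A², so exchanging the variables lowers the
    -- leading coefficient.
    obtain ⟨k, hk1, hk2⟩ := exists_abs_two_mul_add_mul_le A B hA
    have hsq : 4 * (B + k * A) ^ 2 ≤ A ^ 2 := by
      have := sq_le_sq' hk1 hk2
      linarith [mul_pow 2 (B + k * A) 2]
    have hid : A * (A * k ^ 2 + 2 * B * k + C) = (A * C - B ^ 2) + (B + k * A) ^ 2 := by ring
    have hlt : A * k ^ 2 + 2 * B * k + C < A := by
      by_contra hc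
      have : A * A ≤ A * (A * k ^ 2 + 2 * B * k + C) :=
        mul_le_mul_of_nonneg_left (not_lt.mp hc) hA.le
      nlinarith
    have hpos : 0 < A * k ^ 2 + 2 * B * k + C := by
      have : 0 < A * (A * k ^ 2 + 2 * B * k + C) := by
        rw [hid]; positivity
      exact pos_of_mul_pos_right this hA.le
    obtain ⟨p, q, r, s, h1, h2, h3⟩ := ih _ (by omega) (A * k ^ 2 + 2 * B * k + C) (-(B + k * A)) A
      rfl hpos (by linarith [hid])
    refine ⟨p * k - r, q * k - s, p, q, by linarith, ?_, ?_⟩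
    · convert h2 using 1; ring
    · convert h3 using 1 <;> ring

/-- Eliminating g from the two inequalities leaves 27 a³ ≤ 64, so a < 2. -/
theorem eq_one_of_three_mul_sq_le {a g : ℤ} (ha : 0 < a) (hg : 0 < g) (h1 : 3 * a ^ 2 ≤ 4 * g)
    (h2 : 3 * g ^ 2 ≤ 4 * a) : a = 1 ∧ g = 1 := by
  have ha1 : a = 1 := by
    have h3 : (3 * a ^ 2) ^ 2 ≤ (4 * g) ^ 2 := pow_le_pow_left₀ (by positivity) h1 2
    have h4 : a * (27 * a ^ 3) ≤ a * 64 := by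
      have e1 : a * (27 * a ^ 3) = 3 * (3 * a ^ 2) ^ 2 := by ring
      linarith [mul_pow 4 g 2]
    have h5 : 27 * a ^ 3 ≤ 64 := le_of_mul_le_mul_left h4 ha
    by_contra hne
    have : (2 : ℤ) ^ 3 ≤ a ^ 3 := pow_le_pow_left₀ (by norm_num) (by omega) 3
    linarith
  refine ⟨ha1, ?_⟩
  by_contra hne
  have : (2 : ℤ) ^ 2 ≤ g ^ 2 := pow_le_pow_left₀ (by norm_num) (by omega) 2
  linarith

set_option maxHeartbeats 1000000 in
/-- A positive definite integral ternary form of determinant one represents only sums of three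
squares. -/
theorem ternary_det_one_sum_three_sq (n : ℕ) : ∀ a b c d e h : ℤ, a.toNat = n → 0 < a →
    0 < a * b - h ^ 2 → a * b * c + 2 * d * e * h - a * d ^ 2 - b * e ^ 2 - c * h ^ 2 = 1 →
    ∀ x y z : ℤ, ∃ p q r : ℤ,
      a * x ^ 2 + b * y ^ 2 + c * z ^ 2 + 2 * d * y * z + 2 * e * x * z + 2 * h * x * y =
        p ^ 2 + q ^ 2 + r ^ 2 := by
  induction n using Nat.strong_induction_on with
  | _ n ih =>
    intro a b c d e h hn ha hD hdet x y z
    -- Completing the square, a times the form is (a x + h y + e z)² plus a binary form in y, z,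
    -- whose determinant is a times that of the ternary form, hence a. A unimodular change of y, z
    -- brings its leading coefficient g to 3 g² ≤ 4 a.
    have hG : (a * b - h ^ 2) * (a * c - e ^ 2) - (a * d - e * h) ^ 2 = a := by
      linear_combination a * hdet
    obtain ⟨p, q, r, s, hu, hpos, hle⟩ := exists_binary_reduction _ (a * b - h ^ 2) (a * d - e * h)
      (a * c - e ^ 2) rfl hD (by rw [hG]; exact ha)
    rw [hG] at hle
    obtain ⟨h', hh'⟩ : ∃ h', h' = h * p + e * r := ⟨_, rfl⟩
    obtain ⟨e', he'⟩ : ∃ e', e' = h * q + e * s := ⟨_, rfl⟩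
    obtain ⟨b', hb'⟩ : ∃ b', b' = b * p ^ 2 + 2 * d * p * r + c * r ^ 2 := ⟨_, rfl⟩
    obtain ⟨c', hc'⟩ : ∃ c', c' = b * q ^ 2 + 2 * d * q * s + c * s ^ 2 := ⟨_, rfl⟩
    obtain ⟨d', hd'⟩ : ∃ d', d' = b * p * q + d * (p * s + q * r) + c * r * s := ⟨_, rfl⟩
    -- A translation of x by a multiple of the new second variable makes |2 H| ≤ a and leaves g
    -- unchanged.
    obtain ⟨k, hk1, hk2⟩ := exists_abs_two_mul_add_mul_le a h' ha
    obtain ⟨H, hH⟩ : ∃ H, H = h' + k * a := ⟨_, rfl⟩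
    obtain ⟨b2, hb2⟩ : ∃ b2, b2 = a * k ^ 2 + 2 * h' * k + b' := ⟨_, rfl⟩
    obtain ⟨d2, hd2⟩ : ∃ d2, d2 = d' + k * e' := ⟨_, rfl⟩
    rw [← hH] at hk1 hk2
    obtain ⟨g, hg⟩ : ∃ g, g = a * b2 - H ^ 2 := ⟨_, rfl⟩
    have hg' : (a * b - h ^ 2) * p ^ 2 + 2 * (a * d - e * h) * p * r + (a * c - e ^ 2) * r ^ 2
        = g := by
      subst hg hb2 hH hb' hh'; ring
    rw [hg'] at hpos hle
    have hdet' : a * b2 * c' + 2 * d2 * e' * H - a * d2 ^ 2 - b2 * e' ^ 2 - c' * H ^ 2 = 1 := by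
      have : a * b2 * c' + 2 * d2 * e' * H - a * d2 ^ 2 - b2 * e' ^ 2 - c' * H ^ 2 =
        (p * s - q * r) ^ 2 *
          (a * b * c + 2 * d * e * h - a * d ^ 2 - b * e ^ 2 - c * h ^ 2) := by
        subst hb2 hH hd2 hb' hc' hd' hh' he'; ring
      rw [this, hu, hdet]; norm_num
    obtain ⟨Y, hY⟩ : ∃ Y, Y = s * y - q * z := ⟨_, rfl⟩
    obtain ⟨Z, hZ⟩ : ∃ Z, Z = -r * y + p * z := ⟨_, rfl⟩
    have hy : y = p * Y + q * Z := by subst hY hZ; linear_combination (-y) * hu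
    have hz : z = r * Y + s * Z := by subst hY hZ; linear_combination (-z) * hu
    have hval : a * x ^ 2 + b * y ^ 2 + c * z ^ 2 + 2 * d * y * z + 2 * e * x * z + 2 * h * x * y =
        a * (x - k * Y) ^ 2 + b2 * Y ^ 2 + c' * Z ^ 2 + 2 * d2 * Y * Z + 2 * e' * (x - k * Y) * Z
          + 2 * H * (x - k * Y) * Y := by
      rw [hy, hz]; subst hb2 hH hd2 hb' hc' hd' hh' he'; ring
    rw [hval]
    have hsq : 4 * H ^ 2 ≤ a ^ 2 := by
      have := sq_le_sq' hk1 hk2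
      linarith [mul_pow 2 H 2]
    -- If b2 < a, exchanging the first two variables gives a form with smaller leading coefficient.
    -- Otherwise a² ≤ a b2 = g + H² ≤ g + a² / 4, so 3 a² ≤ 4 g, which together with 3 g² ≤ 4 a
    -- forces a = g = 1.
    by_cases hlt : b2 < a
    · have hb2pos : 0 < b2 := by
        have : 0 < a * b2 := by nlinarith [sq_nonneg H]
        exact pos_of_mul_pos_right this ha.le
      obtain ⟨u, v, w, huvw⟩ := ih _ (by omega) b2 a c' e' d2 H rfl hb2pos (by linarith)
        (by linarith) Y (x - k * Y) Z
      exact ⟨u, v, w, by linarith⟩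
    · have h1 : 3 * a ^ 2 ≤ 4 * g := by
        have := mul_le_mul_of_nonneg_left (not_lt.mp hlt) ha.le
        linarith [pow_two a]
      obtain ⟨ha1, hg1⟩ := eq_one_of_three_mul_sq_le ha hpos h1 hle
      subst ha1
      have hH0 : H = 0 := by omega
      have hb21 : b2 = 1 := by rw [hH0] at hg; linarith
      rw [hH0, hb21] at hdet' ⊢
      -- After completing two squares, the coefficient left on Z² is the determinant, which is 1.
      refine ⟨x - k * Y + e' * Z, Y + d2 * Z, Z, ?_⟩
      linear_combination Z ^ 2 * hdet'

/-! ### Forms of determinant one from quadratic residues -/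

/-- The symmetric matrix with rows (m, t, 1), (t, dn - 1, 0), (1, 0, n) has leading minors m, d and
1, and its form takes the value n at (0, 0, 1). -/
theorem sum_three_sq_of_neg_sq_mod {n d t m : ℤ} (hd : 0 < d) (hdn : 0 < d * n - 1)
    (h : t ^ 2 + d = (d * n - 1) * m) : ∃ p q r : ℤ, n = p ^ 2 + q ^ 2 + r ^ 2 := by
  have hm : 0 < m := by
    have : 0 < (d * n - 1) * m := by rw [← h]; positivity
    exact pos_of_mul_pos_right this hdn.le
  obtain ⟨p, q, r, hpqr⟩ := ternary_det_one_sum_three_sq _ m (d * n - 1) n 0 1 t rfl hm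
    (by linarith) (by linear_combination (-n) * h) 0 0 1
  exact ⟨p, q, r, by linarith⟩

theorem exists_sq_add_eq_mul_of_jacobiSym {p : ℕ} (hp : p.Prime) {d : ℤ}
    (h : jacobiSym (-d) p = 1) : ∃ t m : ℤ, t ^ 2 + d = p * m := by
  have := Fact.mk hp
  obtain ⟨x, hx⟩ := ZMod.isSquare_of_jacobiSym_eq_one h
  obtain ⟨t, rfl⟩ := ZMod.intCast_surjective x
  have : ((t ^ 2 + d : ℤ) : ZMod p) = 0 := by
    push_cast at hx ⊢
    rw [pow_two, ← hx]; ring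
  obtain ⟨m, hm⟩ := (ZMod.intCast_zmod_eq_zero_iff_dvd _ _).mp this
  exact ⟨t, m, hm⟩

open NumberTheorySymbols in
-- Dirichlet's theorem gives a prime p = dn - 1 with d ≡ 1 modulo 4; then p ≡ 1 modulo 4 as well.
-- Reciprocity yields (-d | p) = (p | d) = (-1 | d) = 1, because p ≡ -1 modulo d.
theorem sum_three_sq_of_mod_four_eq_two {n : ℕ} (hn : n % 4 = 2) :
    ∃ p q r : ℤ, (n : ℤ) = p ^ 2 + q ^ 2 + r ^ 2 := by
  have hcop : (n - 1).Coprime (4 * n) := by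
    apply Nat.Coprime.mul_right
    · exact Nat.Coprime.pow_right 2 (Nat.coprime_two_right.mpr (by rw [Nat.odd_iff]; omega))
    · have := Nat.coprime_self_add_right (m := n - 1) (n := 1)
      rw [show n - 1 + 1 = n by omega] at this
      exact this.mpr (Nat.coprime_one_right _)
  obtain ⟨p, hpn, hp, hmod⟩ := Nat.forall_exists_prime_gt_and_modEq n (q := 4 * n) (by omega) hcop
  obtain ⟨j, hj⟩ := (Nat.modEq_iff_dvd' (by omega)).mp hmod.symm
  have hpj : p = (4 * j + 1) * n - 1 := by
    have : (4 * j + 1) * n = 4 * n * j + n := by ring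
    omega
  have hp1 : p % 4 = 1 := by
    have : p = 4 * (n * j) + (n - 1) := by
      rw [← mul_assoc]; omega
    omega
  obtain ⟨d, hd⟩ : ∃ d, d = 4 * j + 1 := ⟨_, rfl⟩
  rw [← hd] at hpj
  have hdn : (d : ℤ) * n - 1 = p := by
    have : 1 ≤ d * n := Nat.mul_pos (by omega) (by omega)
    rw [hpj]; push_cast [Nat.cast_sub this]; ring
  have hJ : J(-(d : ℤ) | p) = 1 := by
    rw [jacobiSym.neg _ (by rw [Nat.odd_iff]; omega), ZMod.χ₄_nat_one_mod_four hp1, one_mul,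
      jacobiSym.quadratic_reciprocity_one_mod_four (by omega) (by rw [Nat.odd_iff]; omega),
      jacobiSym.mod_left' (a₂ := -1), jacobiSym.at_neg_one (by rw [Nat.odd_iff]; omega),
      ZMod.χ₄_nat_one_mod_four (by omega)]
    exact Int.modEq_iff_dvd.mpr ⟨-n, by rw [← hdn]; ring⟩
  obtain ⟨t, m, htm⟩ := exists_sq_add_eq_mul_of_jacobiSym hp hJ
  exact sum_three_sq_of_neg_sq_mod (d := d) (by omega) (by rw [hdn]; exact_mod_cast hp.pos)
    (by rw [hdn, htm])

open NumberTheorySymbols in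
-- Here dn - 1 is even, so the prime is sought as p = (dn - 1) / 2. Since 2p ≡ -1 modulo d,
-- reciprocity gives (-d | p) = (p | d) = (-2 | d), which is 1 when d is 1 or 3 modulo 8.
theorem sum_three_sq_of_odd {n : ℕ} (hn : n % 8 = 1 ∨ n % 8 = 3 ∨ n % 8 = 5) :
    ∃ p q r : ℤ, (n : ℤ) = p ^ 2 + q ^ 2 + r ^ 2 := by
  -- c is the residue of d modulo 8 and m that of p modulo 4n. The choice c = 3 for n ≡ 1, 5 and c =
  -- 1 for n ≡ 3 makes m odd, and m ≡ 3 modulo 4 occurs only with c = 3, so that the sign in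
  -- reciprocity cancels the one from (-1 | p).
  obtain ⟨c, m, hc, hm, hcn⟩ : ∃ c m : ℕ, (c = 1 ∨ c = 3) ∧ 2 * m + 1 = c * n ∧
      (m % 4 = 1 ∨ m % 4 = 3 ∧ c = 3) := by
    rcases hn with h | h | h
    · exact ⟨3, (3 * n - 1) / 2, by omega⟩
    · exact ⟨1, (n - 1) / 2, by omega⟩
    · exact ⟨3, (3 * n - 1) / 2, by omega⟩
  have hcop : m.Coprime (4 * n) := by
    apply Nat.Coprime.mul_right
    · exact Nat.Coprime.pow_right 2 (Nat.coprime_two_right.mpr (by rw [Nat.odd_iff]; omega))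
    · have h1 : m.Coprime (c * n) := by
        rw [← hm]
        simp
      exact h1.coprime_mul_left_right
  obtain ⟨p, hpn, hp, hmod⟩ :=
    Nat.forall_exists_prime_gt_and_modEq (m + 2) (q := 4 * n) (by omega) hcop
  obtain ⟨j, hj⟩ := (Nat.modEq_iff_dvd' (by omega)).mp hmod.symm
  obtain ⟨d, hd⟩ : ∃ d, d = 8 * j + c := ⟨_, rfl⟩
  have hpm : p = 4 * (n * j) + m := by
    rw [← mul_assoc]; omega
  have hpd : 2 * p + 1 = d * n := by
    rw [hpm, hd, add_mul, ← hm]; ring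
  have hdn : (d : ℤ) * n - 1 = 2 * p := by
    have : (2 * p + 1 : ℤ) = d * n := by exact_mod_cast hpd
    linarith
  have hpodd : Odd p := by rw [Nat.odd_iff]; omega
  have hdodd : Odd d := by rw [Nat.odd_iff]; omega
  have hpd1 : J(-(d : ℤ) | p) = J((p : ℤ) | d) := by
    rw [jacobiSym.neg _ hpodd]
    rcases hcn with h | h
    · rw [ZMod.χ₄_nat_one_mod_four (by omega), one_mul,
        jacobiSym.quadratic_reciprocity_one_mod_four' hdodd (by omega)]
    · rw [ZMod.χ₄_nat_three_mod_four (by omega),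
        jacobiSym.quadratic_reciprocity_three_mod_four (by omega) (by omega)]
      ring
  have h2 : J((2 : ℤ) | d) * J((2 : ℤ) | d) = 1 := by
    rw [← pow_two]
    apply jacobiSym.sq_one
    rw [Int.gcd_eq_natAbs]
    simpa using hdodd
  have hprod : J((2 : ℤ) | d) * J((p : ℤ) | d) = J(-1 | d) := by
    rw [← jacobiSym.mul_left]
    apply jacobiSym.mod_left'
    exact Int.modEq_iff_dvd.mpr ⟨-n, by rw [← hdn]; ring⟩
  have hJ : J(-(d : ℤ) | p) = 1 := by
    rw [hpd1]
    have : J((p : ℤ) | d) = J(-2 | d) := by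
      rw [show (-2 : ℤ) = 2 * -1 by norm_num, jacobiSym.mul_left, ← hprod, ← mul_assoc, h2,
        one_mul]
    rw [this, jacobiSym.at_neg_two hdodd, ZMod.χ₈'_nat_eq_if_mod_eight]
    rw [if_neg (by omega), if_pos (by omega)]
  obtain ⟨t, k, htk⟩ := exists_sq_add_eq_mul_of_jacobiSym hp hJ
  -- The modulus is 2p, not p: adding the odd number p to an even root makes u odd, so u² + d is
  -- even too.
  obtain ⟨u, l, hodd, hu⟩ : ∃ u l : ℤ, u % 2 = 1 ∧ u ^ 2 + d = p * l := by
    rcases Int.emod_two_eq_zero_or_one t with h | h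
    · exact ⟨t + p, k + 2 * t + p, by rw [Nat.odd_iff] at hpodd; omega, by linear_combination htk⟩
    · exact ⟨t, k, h, htk⟩
  have hl : (p * l) % 2 = 0 := by
    rw [← hu]
    have : (u ^ 2) % 2 = 1 := by rw [pow_two, Int.mul_emod, hodd]; norm_num
    rw [Nat.odd_iff] at hdodd
    omega
  have hl2 : Even l := by
    rcases Int.even_mul.mp (Int.even_iff.mpr hl) with h | h
    · rw [Nat.odd_iff] at hpodd; rw [Int.even_iff] at h; omega
    · exact h
  obtain ⟨l', rfl⟩ := hl2
  exact sum_three_sq_of_neg_sq_mod (d := d) (t := u) (m := l') (by omega)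
    (by rw [hdn]; have := hp.pos; omega) (by rw [hdn, hu]; ring)

/-! ### Congruence obstructions and Legendre's theorem -/

theorem eight_dvd_add_one_not_sum_three_sq {y : ℤ} (hy : 8 ∣ y + 1) (p q r : ℤ) :
    y ≠ p ^ 2 + q ^ 2 + r ^ 2 := by
  rintro rfl
  have key : ∀ x : ℤ, x ^ 2 % 8 = 0 ∨ x ^ 2 % 8 = 1 ∨ x ^ 2 % 8 = 4 := by
    intro x
    have : x % 8 = 0 ∨ x % 8 = 1 ∨ x % 8 = 2 ∨ x % 8 = 3 ∨ x % 8 = 4 ∨ x % 8 = 5 ∨ x % 8 = 6 ∨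
      x % 8 = 7 := by omega
    rcases this with h | h | h | h | h | h | h | h <;> simp [pow_two, Int.mul_emod, h]
  have := key p
  have := key q
  have := key r
  omega

/-- Squares are 0 or 1 modulo 4, so no odd term can occur. This allows descent through powers of
four. -/
theorem even_of_four_dvd_sum_three_sq {p q r : ℤ} (h : 4 ∣ p ^ 2 + q ^ 2 + r ^ 2) :
    2 ∣ p ∧ 2 ∣ q ∧ 2 ∣ r := by
  have key : ∀ x : ℤ, x % 2 = 0 ∧ x ^ 2 % 4 = 0 ∨ x % 2 = 1 ∧ x ^ 2 % 4 = 1 := by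
    intro x
    have : x % 4 = 0 ∨ x % 4 = 1 ∨ x % 4 = 2 ∨ x % 4 = 3 := by omega
    rcases this with h | h | h | h <;> simp [pow_two, Int.mul_emod, h] <;> omega
  have := key p
  have := key q
  have := key r
  omega

/-- Legendre's three-square theorem. -/
theorem four_pow_mul_eq_sum_three_sq_iff (a : ℕ) {y : ℤ} (hy : ¬ 4 ∣ y) :
    (∃ p q r : ℤ, 4 ^ a * y = p ^ 2 + q ^ 2 + r ^ 2) ↔ 0 < y ∧ ¬ 8 ∣ y + 1 := by
  constructor
  · induction a with
    | zero =>
      rintro ⟨p, q, r, h⟩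
      rw [pow_zero, one_mul] at h
      refine ⟨lt_of_le_of_ne (by rw [h]; positivity) (by rintro rfl; simp at hy), fun h8 => ?_⟩
      exact eight_dvd_add_one_not_sum_three_sq h8 p q r h
    | succ a ih =>
      rintro ⟨p, q, r, h⟩
      obtain ⟨⟨p, rfl⟩, ⟨q, rfl⟩, ⟨r, rfl⟩⟩ :=
        even_of_four_dvd_sum_three_sq (p := p) (q := q) (r := r) ⟨4 ^ a * y, by rw [← h]; ring⟩
      exact ih ⟨p, q, r, by rw [pow_succ] at h; linarith⟩
  · rintro ⟨hpos, h8⟩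
    obtain ⟨p, q, r, h⟩ : ∃ p q r : ℤ, y = p ^ 2 + q ^ 2 + r ^ 2 := by
      lift y to ℕ using hpos.le
      by_cases h : y % 4 = 2
      · exact sum_three_sq_of_mod_four_eq_two h
      · exact sum_three_sq_of_odd (by omega)
    exact ⟨2 ^ a * p, 2 ^ a * q, 2 ^ a * r, by
      rw [h, show (4 : ℤ) = 2 ^ 2 by norm_num, ← pow_mul]; ring⟩

end ThreeSquares

end SLPComplexity

namespace SLPComplexity

/-! ### Encodings and values of straight-line programs -/

section Programs

/-! ### Unique readability of the codes -/

/-- Every digit `d` is written as `1d`. -/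
def pairs (l : List Bool) : List Bool := l.flatMap fun d => [true, d]

@[simp] theorem pairs_nil : pairs [] = [] := rfl

@[simp] theorem pairs_cons (d : Bool) (l : List Bool) : pairs (d :: l) = true :: d :: pairs l := rfl

theorem pairs_append (l l' : List Bool) : pairs (l ++ l') = pairs l ++ pairs l' := by
  simp [pairs]

theorem encodeNat_eq (n : ℕ) : encodeNat n = pairs n.bits ++ [false] := rfl

/-- The code is prefix-free: the first letter of each block tells whether another digit follows. -/
theorem pairs_append_false_inj {l l' x y : List Bool}
    (h : pairs l ++ false :: x = pairs l' ++ false :: y) : l = l' ∧ x = y := by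
  induction l generalizing l' with
  | nil => cases l' <;> simp_all
  | cons d l ih =>
    cases l' with
    | nil => simp at h
    | cons d' l' =>
      simp only [pairs_cons, List.cons_append, List.cons.injEq, true_and] at h
      obtain ⟨h1, h2⟩ := ih h.2
      exact ⟨by rw [h.1, h1], h2⟩

theorem foldr_bit_bits (n : ℕ) : n.bits.foldr Nat.bit 0 = n := by
  induction n using Nat.binaryRec' with
  | zero => simp
  | bit b n h ih => rw [Nat.bits_append_bit _ _ h]; simp [ih]

theorem bits_inj {m n : ℕ} (h : m.bits = n.bits) : m = n := by
  rw [← foldr_bit_bits m, h, foldr_bit_bits]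

theorem encodeNat_append_inj {m n : ℕ} {x y : List Bool} (h : encodeNat m ++ x = encodeNat n ++ y) :
    m = n ∧ x = y := by
  simp only [encodeNat_eq, List.append_assoc, List.singleton_append] at h
  obtain ⟨h1, h2⟩ := pairs_append_false_inj h
  exact ⟨bits_inj h1, h2⟩

/-- The description of a list of instructions. -/
def encodeInstrs (L : List Instr) : List Bool := L.flatMap encodeInstr

@[simp] theorem encodeInstrs_nil : encodeInstrs [] = [] := rfl

theorem encodeInstrs_cons (I : Instr) (L : List Instr) :
    encodeInstrs (I :: L) = encodeInstr I ++ encodeInstrs L := rfl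

theorem encodeInstrs_append (L L' : List Instr) :
    encodeInstrs (L ++ L') = encodeInstrs L ++ encodeInstrs L' := by
  simp [encodeInstrs]

theorem encodeInstr_append_inj {I J : Instr} {x y : List Bool}
    (h : encodeInstr I ++ x = encodeInstr J ++ y) : I = J ∧ x = y := by
  obtain ⟨o, i, j⟩ := I
  obtain ⟨o', i', j'⟩ := J
  simp only [encodeInstr, List.append_assoc] at h
  have ho : o = o' := by
    cases o <;> cases o' <;> simp_all [encodeOp]
  subst ho
  obtain ⟨rfl, h2⟩ := encodeNat_append_inj (List.append_cancel_left h)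
  obtain ⟨rfl, h3⟩ := encodeNat_append_inj h2
  exact ⟨rfl, h3⟩

theorem encodeInstrs_inj {L L' : List Instr} (h : encodeInstrs L = encodeInstrs L') : L = L' := by
  have hne : ∀ (I : Instr) (x : List Bool), encodeInstr I ++ x ≠ [] := by
    rintro ⟨o, i, j⟩ x
    cases o <;> simp [encodeInstr, encodeOp]
  induction L generalizing L' with
  | nil =>
    cases L' with
    | nil => rfl
    | cons I L' => exact absurd h.symm (hne _ _)
  | cons I L ih =>
    cases L' with
    | nil => exact absurd h (hne _ _)
    | cons J L' =>
      obtain ⟨rfl, h2⟩ := encodeInstr_append_inj h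
      rw [ih h2]

theorem length_le_length_encodeInstrs (L : List Instr) : L.length ≤ (encodeInstrs L).length := by
  induction L with
  | nil => simp
  | cons I L ih =>
    obtain ⟨o, i, j⟩ := I
    rw [encodeInstrs_cons, List.length_append, List.length_cons]
    cases o <;> simp only [encodeInstr, encodeOp, List.length_append, List.length_cons] <;> omega

/-! ### Values of instruction lists and oracle membership -/

/-- The list of all numbers computed by a list of instructions. -/
def values (L : List Instr) : List ℤ := L.foldl execInstr [1]

/-- Every instruction refers only to numbers computed before it. -/
def WellFormed (L : List Instr) : Prop :=
  ∀ (i : ℕ) (h : i < L.length), L[i].fst ≤ i ∧ L[i].snd ≤ i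

theorem values_concat (L : List Instr) (I : Instr) :
    values (L ++ [I]) =
      values L ++ [I.op.eval ((values L).getD I.fst 0) ((values L).getD I.snd 0)] := by
  simp [values, execInstr]

theorem length_values (L : List Instr) : (values L).length = L.length + 1 := by
  induction L using List.reverseRecOn with
  | nil => rfl
  | append_singleton L I ih => simp [values_concat, ih]

theorem WellFormed.concat {L : List Instr} (h : WellFormed L) {I : Instr} (h1 : I.fst ≤ L.length)
    (h2 : I.snd ≤ L.length) : WellFormed (L ++ [I]) := by
  intro i hi
  rw [List.getElem_append]
  split
  · exact h i _
  · simp only [List.length_append, List.length_cons, List.length_nil] at hi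
    obtain rfl : i = L.length := by omega
    simpa using ⟨h1, h2⟩

theorem getD_values_concat_of_le (L : List Instr) (I : Instr) {k : ℕ} (hk : k ≤ L.length) :
    (values (L ++ [I])).getD k 0 = (values L).getD k 0 := by
  rw [values_concat, List.getD_append _ _ _ _ (by rw [length_values]; omega)]

theorem getD_values_concat_last (L : List Instr) (I : Instr) :
    (values (L ++ [I])).getD (L.length + 1) 0 =
      I.op.eval ((values L).getD I.fst 0) ((values L).getD I.snd 0) := by
  rw [values_concat, List.getD_append_right _ _ _ _ (by rw [length_values])]
  simp [length_values]

theorem getLastD_values (L : List Instr) :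
    (values L).getLastD 0 = (values L).getD L.length 0 := by
  rw [List.getLastD_eq_getLast?, List.getLast?_eq_getElem?, length_values, List.getD_eq_getElem?_getD]
  rfl

/-- One operation turns a bound B ≥ 2 into at most B², because 2B ≤ B² covers sums and differences.
-/
theorem abs_le_of_mem_values (L : List Instr) : ∀ x ∈ values L, |x| ≤ 2 ^ 2 ^ L.length := by
  induction L using List.reverseRecOn with
  | nil => simp [values]
  | append_singleton L I ih =>
    have hB : (2 : ℤ) ≤ 2 ^ 2 ^ L.length := by
      calc (2 : ℤ) = 2 ^ 1 := by norm_num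
        _ ≤ _ := pow_le_pow_right₀ (by norm_num) Nat.one_le_two_pow
    have hsq : (2 : ℤ) ^ 2 ^ (L ++ [I]).length = 2 ^ 2 ^ L.length * 2 ^ 2 ^ L.length := by
      rw [List.length_append, List.length_singleton, pow_succ, ← pow_add]
      ring_nf
    have hD : ∀ k, |(values L).getD k 0| ≤ 2 ^ 2 ^ L.length := by
      intro k
      by_cases hk : k < (values L).length
      · rw [List.getD_eq_getElem _ _ hk]
        exact ih _ (List.getElem_mem hk)
      · rw [List.getD_eq_default _ _ (not_lt.mp hk), abs_zero]
        positivity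
    intro x hx
    rw [hsq]
    rw [values_concat, List.mem_append, List.mem_singleton] at hx
    rcases hx with hx | rfl
    · nlinarith [ih x hx]
    · have h1 := hD I.fst
      have h2 := hD I.snd
      cases I.op with
      | add => exact (abs_add_le _ _).trans (by nlinarith)
      | sub => exact (abs_sub _ _).trans (by nlinarith)
      | mul =>
        simp only [Op.eval, abs_mul]
        exact mul_le_mul h1 h2 (abs_nonneg _) (by positivity)

/-- Since codes are injective, the existential over programs in each language collapses to the one
program that was written down. -/
theorem exists_SLP_iff {p : ℤ → Prop} {L : List Instr} (h : WellFormed L) :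
    (∃ P : SLP, encodeInstrs L = P.encode ∧ p P.value) ↔ p ((values L).getD L.length 0) := by
  rw [← getLastD_values]
  constructor
  · rintro ⟨P, hP, hp⟩
    have : L = P.instrs := encodeInstrs_inj hP
    subst this
    exact hp
  · exact fun hp => ⟨⟨L, h⟩, rfl, hp⟩

theorem encodeInstrs_mem_PosSLP {L : List Instr} (h : WellFormed L) :
    encodeInstrs L ∈ PosSLP ↔ 0 < (values L).getD L.length 0 :=
  exists_SLP_iff h

theorem encodeInstrs_mem_ThreeSoSSLP {L : List Instr} (h : WellFormed L) :
    encodeInstrs L ∈ ThreeSoSSLP ↔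
      ∃ a b c : ℤ, (values L).getD L.length 0 = a ^ 2 + b ^ 2 + c ^ 2 :=
  exists_SLP_iff (p := fun N => ∃ a b c : ℤ, N = a ^ 2 + b ^ 2 + c ^ 2) h

theorem encodeNat_append_mem_Div2SLP {L : List Instr} (h : WellFormed L) (l : ℕ) :
    encodeNat l ++ encodeInstrs L ∈ Div2SLP ↔ (2 : ℤ) ^ l ∣ (values L).getD L.length 0 := by
  rw [← exists_SLP_iff (p := fun N => (2 : ℤ) ^ l ∣ N) h]
  constructor
  · rintro ⟨P, k, h1, h2⟩
    obtain ⟨rfl, h3⟩ := encodeNat_append_inj h1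
    exact ⟨P, h3, (dvd_abs _ _).mp h2⟩
  · rintro ⟨P, h1, h2⟩
    exact ⟨P, l, by rw [h1], (dvd_abs _ _).mpr h2⟩

/-- The leading 0 codes the exponent zero, and 2^0 divides everything, so the oracle serves as a
syntax checker. -/
theorem false_cons_mem_Div2SLP {w : List Bool} :
    false :: w ∈ Div2SLP ↔ ∃ L, WellFormed L ∧ w = encodeInstrs L := by
  constructor
  · rintro ⟨P, k, h1, -⟩
    obtain ⟨-, h3⟩ := encodeNat_append_inj (m := 0) (x := w) (by simpa [encodeNat] using h1)
    exact ⟨P.instrs, P.wf, h3⟩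
  · rintro ⟨L, hL, rfl⟩
    exact (encodeNat_append_mem_Div2SLP hL 0).mpr (by simp)

theorem exists_wellFormed_of_mem_ThreeSoSSLP {w : List Bool} (h : w ∈ ThreeSoSSLP) :
    ∃ L, WellFormed L ∧ w = encodeInstrs L := by
  obtain ⟨P, rfl, -⟩ := h
  exact ⟨P.instrs, P.wf, rfl⟩

/-- `L` is well formed of length `i`, its last number is `s`, and its `m`-th number is `N`. -/
structure Computes (L : List Instr) (i : ℕ) (s : ℤ) (m : ℕ) (N : ℤ) : Prop where
  wf : WellFormed L
  length_eq : L.length = i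
  last : (values L).getD i 0 = s
  le : m ≤ i
  mth : (values L).getD m 0 = N

theorem Computes.concat {L : List Instr} {i m : ℕ} {s N : ℤ} (h : Computes L i s m N) (I : Instr)
    (h1 : I.fst ≤ i) (h2 : I.snd ≤ i) :
    Computes (L ++ [I]) (i + 1)
      (I.op.eval ((values L).getD I.fst 0) ((values L).getD I.snd 0)) m N := by
  obtain ⟨hw, rfl, rfl, hm, rfl⟩ := h
  exact ⟨hw.concat h1 h2, by simp, getD_values_concat_last L I, by omega,
    getD_values_concat_of_le L I hm⟩

theorem Computes.concat_last {L : List Instr} {i m : ℕ} {s N : ℤ} (h : Computes L i s m N)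
    (o : Op) : Computes (L ++ [⟨o, i, i⟩]) (i + 1) (o.eval s s) m N := by
  have := h.concat ⟨o, i, i⟩ le_rfl le_rfl
  rwa [h.last] at this

/-- If `4 ^ a` is the largest power of four that divides `N`, then the sign and the `2`-adic
valuation of `4 ^ a * (N + 4 ^ a)` tell whether `N` is a sum of three squares. -/
theorem sum_three_sq_iff_of_four_pow {N : ℤ} {a : ℕ} (h1 : (4 : ℤ) ^ a ∣ N)
    (h2 : N ≠ 0 → ¬ (4 : ℤ) ^ (a + 1) ∣ N) :
    (∃ x y z : ℤ, N = x ^ 2 + y ^ 2 + z ^ 2) ↔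
      0 < 4 ^ a * (N + 4 ^ a) ∧ ¬ (2 : ℤ) ^ (4 * a + 3) ∣ 4 ^ a * (N + 4 ^ a) := by
  obtain ⟨y, rfl⟩ := h1
  have h4 : (0 : ℤ) < 4 ^ a := by positivity
  have e : (4 : ℤ) ^ a * (4 ^ a * y + 4 ^ a) = 4 ^ a * 4 ^ a * (y + 1) := by ring
  have e2 : (2 : ℤ) ^ (4 * a + 3) = 4 ^ a * 4 ^ a * 8 := by
    rw [show (4 : ℤ) = 2 ^ 2 by norm_num, ← pow_mul, ← pow_add, pow_add _ _ 3]
    congr 2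
    ring
  rw [e, e2, mul_dvd_mul_iff_left (by positivity), mul_pos_iff_of_pos_left (by positivity)]
  -- The tested number sees only y + 1 > 0, that is y ≥ 0. The extra case y = 0 is harmless, as 0 is
  -- a sum of three squares and 8 ∤ 1.
  by_cases hy : y = 0
  · subst hy
    exact ⟨fun _ => by norm_num, fun _ => ⟨0, 0, 0, by simp⟩⟩
  · have hy4 : ¬ 4 ∣ y := by
      rintro ⟨z, rfl⟩
      exact h2 (mul_ne_zero h4.ne' hy) ⟨z, by ring⟩
    rw [four_pow_mul_eq_sum_three_sq_iff a hy4]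
    omega

end Programs

end SLPComplexity

namespace SLPComplexity

/-! ### A structured programming language for oracle machines -/

section Language

/-- Structured programs over stacks of bits indexed by `K`, with oracles from `𝒪`. -/
inductive Cmd (𝒪 : Set (Language Bool)) (K : Type) : Type 1
  | push (k : K) (b : Bool)
  | pop (k : K)
  | skip
  | seq (c d : Cmd 𝒪 K)
  | ite (k : K) (p : Option Bool → Bool) (c d : Cmd 𝒪 K)
  | loop (k : K) (p : Option Bool → Bool) (c : Cmd 𝒪 K)
  | ask (A : 𝒪) (k : K) (c d : Cmd 𝒪 K)

namespace Cmd

variable {𝒪 : Set (Language Bool)} {K : Type}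

/-- The control points of a program. -/
def Pos : Cmd 𝒪 K → Type
  | push _ _ => Unit
  | pop _ => Unit
  | skip => Unit
  | seq c d => Pos c ⊕ Pos d
  | ite _ _ c d => Option (Pos c ⊕ Pos d)
  | loop _ _ c => Option (Pos c)
  | ask _ _ c d => Option (Pos c ⊕ Pos d)

/-- The control points of a program are finite in number. -/
@[reducible]
def fintypePos : (c : Cmd 𝒪 K) → Fintype (Pos c)
  | push _ _ => inferInstanceAs (Fintype Unit)
  | pop _ => inferInstanceAs (Fintype Unit)
  | skip => inferInstanceAs (Fintype Unit)
  | seq c d =>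
    letI := fintypePos c; letI := fintypePos d; inferInstanceAs (Fintype (Pos c ⊕ Pos d))
  | ite _ _ c d =>
    letI := fintypePos c; letI := fintypePos d; inferInstanceAs (Fintype (Option (Pos c ⊕ Pos d)))
  | loop _ _ c => letI := fintypePos c; inferInstanceAs (Fintype (Option (Pos c)))
  | ask _ _ c d =>
    letI := fintypePos c; letI := fintypePos d; inferInstanceAs (Fintype (Option (Pos c ⊕ Pos d)))

/-- The control point at which a program starts. -/
def entry : (c : Cmd 𝒪 K) → Pos c
  | push _ _ => ()
  | pop _ => ()
  | skip => ()
  | seq c _ => Sum.inl (entry c)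
  | ite _ _ _ _ => none
  | loop _ _ _ => none
  | ask _ _ _ _ => none

/-- The oracle calls of a program. -/
def calls : (c : Cmd 𝒪 K) → Pos c → Option (𝒪 × K)
  | push _ _ => fun _ => none
  | pop _ => fun _ => none
  | skip => fun _ => none
  | seq c d => Sum.elim (calls c) (calls d)
  | ite _ _ c d => fun x => x.elim none (Sum.elim (calls c) (calls d))
  | loop _ _ c => fun x => x.elim none (calls c)
  | ask A k c d => fun x => x.elim (some (A, k)) (Sum.elim (calls c) (calls d))

/-- Jump to a label. -/
def jump {L : Type} (l : L) : Turing.TM2.Stmt (fun _ : K => Bool) L (Option Bool) :=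
  .goto fun _ => l

/-- The machine code of a program that is embedded into a larger machine with labels `L` and is
left through the label `exit`. -/
def code {L : Type} : (c : Cmd 𝒪 K) → (Pos c → L) → L → Pos c →
    Turing.TM2.Stmt (fun _ : K => Bool) L (Option Bool)
  | push k b => fun _ exit _ => .push k (fun _ => b) (jump exit)
  | pop k => fun _ exit _ => .pop k (fun v _ => v) (jump exit)
  | skip => fun _ exit _ => jump exit
  | seq c d => fun e exit => Sum.elim
      (code c (fun x => e (Sum.inl x)) (e (Sum.inr (entry d))))
      (code d (fun x => e (Sum.inr x)) exit)
  | ite k p c d => fun e exit x => x.elim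
      (.peek k (fun _ o => o)
        (.branch p (jump (e (some (Sum.inl (entry c))))) (jump (e (some (Sum.inr (entry d)))))))
      (Sum.elim (code c (fun x => e (some (Sum.inl x))) exit)
        (code d (fun x => e (some (Sum.inr x))) exit))
  | loop k p c => fun e exit x => x.elim
      (.peek k (fun _ o => o) (.branch p (jump (e (some (entry c)))) (jump exit)))
      (code c (fun x => e (some x)) (e none))
  | ask _ _ c d => fun e exit x => x.elim
      (.branch (fun v => v == some true)
        (jump (e (some (Sum.inl (entry c))))) (jump (e (some (Sum.inr (entry d))))))
      (Sum.elim (code c (fun x => e (some (Sum.inl x))) exit)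
        (code d (fun x => e (some (Sum.inr x))) exit))

variable [DecidableEq K]

/-! ### Running times and simulation by the oracle machine -/

/-- `Runs c S t S'`: started with stacks `S`, the program `c` ends after at most `t` steps with
stacks `S'`. -/
inductive Runs : Cmd 𝒪 K → (K → List Bool) → ℕ → (K → List Bool) → Prop
  | push (k : K) (b : Bool) (S : K → List Bool) :
      Runs (push k b) S 1 (Function.update S k (b :: S k))
  | pop (k : K) (S : K → List Bool) : Runs (pop k) S 1 (Function.update S k (S k).tail)
  | skip (S : K → List Bool) : Runs skip S 1 S
  | seq {c d : Cmd 𝒪 K} {S S' S'' : K → List Bool} {t t' : ℕ} :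
      Runs c S t S' → Runs d S' t' S'' → Runs (seq c d) S (t + t') S''
  | ite_true {k : K} {p : Option Bool → Bool} {c d : Cmd 𝒪 K} {S S' : K → List Bool} {t : ℕ} :
      p (S k).head? = true → Runs c S t S' → Runs (ite k p c d) S (t + 1) S'
  | ite_false {k : K} {p : Option Bool → Bool} {c d : Cmd 𝒪 K} {S S' : K → List Bool} {t : ℕ} :
      p (S k).head? = false → Runs d S t S' → Runs (ite k p c d) S (t + 1) S'
  | loop_true {k : K} {p : Option Bool → Bool} {c : Cmd 𝒪 K} {S S' S'' : K → List Bool}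
      {t t' : ℕ} : p (S k).head? = true → Runs c S t S' → Runs (loop k p c) S' t' S'' →
      Runs (loop k p c) S (t + t' + 1) S''
  | loop_false {k : K} {p : Option Bool → Bool} {c : Cmd 𝒪 K} {S : K → List Bool} :
      p (S k).head? = false → Runs (loop k p c) S 1 S
  | ask_true {A : 𝒪} {k : K} {c d : Cmd 𝒪 K} {S S' : K → List Bool} {t : ℕ} :
      S k ∈ (A : Language Bool) → Runs c S t S' → Runs (ask A k c d) S (t + 1) S'
  | ask_false {A : 𝒪} {k : K} {c d : Cmd 𝒪 K} {S S' : K → List Bool} {t : ℕ} :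
      S k ∉ (A : Language Bool) → Runs d S t S' → Runs (ask A k c d) S (t + 1) S'
  | mono {c : Cmd 𝒪 K} {S S' : K → List Bool} {t t' : ℕ} : Runs c S t S' → t ≤ t' → Runs c S t' S'

theorem Runs.cast {c : Cmd 𝒪 K} {S S' S'' : K → List Bool} {t t' : ℕ} (h : Runs c S t S')
    (hS : S' = S'') (ht : t ≤ t') : Runs c S t' S'' :=
  hS ▸ h.mono ht

/-- `ReachesIn M t a b`: the machine `M` passes from `a` to `b` in at most `t` steps. -/
def ReachesIn (M : OracleTM 𝒪) (t : ℕ) (a b : M.Cfg) : Prop :=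
  ∃ n ≤ t, (flip bind M.step)^[n] (some a) = some b

theorem ReachesIn.trans {M : OracleTM 𝒪} {t t' : ℕ} {a b c : M.Cfg} (h : ReachesIn M t a b)
    (h' : ReachesIn M t' b c) : ReachesIn M (t + t') a c := by
  obtain ⟨n, hn, e⟩ := h
  obtain ⟨n', hn', e'⟩ := h'
  exact ⟨n' + n, by omega, by rw [Function.iterate_add_apply, e, e']⟩

theorem ReachesIn.mono {M : OracleTM 𝒪} {t t' : ℕ} {a b : M.Cfg} (h : ReachesIn M t a b)
    (ht : t ≤ t') : ReachesIn M t' a b := by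
  obtain ⟨n, hn, e⟩ := h
  exact ⟨n, hn.trans ht, e⟩

theorem ReachesIn.of_step {M : OracleTM 𝒪} {a b : M.Cfg} (h : M.step a = some b) :
    ReachesIn M 1 a b :=
  ⟨1, le_rfl, h⟩

/-- The machine that runs the program `c` on an input given on stack `input`, and accepts if in the
end the letter on top of stack `output` is `1`. -/
def toMachine [Fintype K] (c : Cmd 𝒪 K) (input output : K) : OracleTM 𝒪 where
  K := K
  Λ := Option (Pos c)
  finΛ := letI := fintypePos c; inferInstance
  σ := Option Bool
  inputStack := input
  main := some (entry c)
  initialState := none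
  accept v := v == some true
  query x := x.elim none (calls c)
  receive _ b := some b
  prog x := x.elim (.peek output (fun _ o => o) .halt) (code c some none)

section Simulation

variable [Fintype K] (c₀ : Cmd 𝒪 K) (input output : K)

/-- The program `c` is embedded into the machine of `c₀` by `e`. -/
structure Embedded (c : Cmd 𝒪 K) (e : Pos c → Option (Pos c₀)) (exit : Option (Pos c₀)) :
    Prop where
  prog : ∀ x, (toMachine c₀ input output).prog (e x) = code c e exit x
  query : ∀ x, (toMachine c₀ input output).query (e x) = calls c x

variable {c₀ input output}

theorem step_of_calls_none {c : Cmd 𝒪 K} {e : Pos c → Option (Pos c₀)} {exit : Option (Pos c₀)}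
    (h : Embedded c₀ input output c e exit) {x : Pos c} (hx : calls c x = none) (v : Option Bool)
    (S : K → List Bool) :
    (toMachine c₀ input output).step ⟨some (e x), v, S⟩ =
      some (Turing.TM2.stepAux (code c e exit x) v S) := by
  have hq := (h.query x).trans hx
  simp only [OracleTM.step, OracleTM.consult, hq]
  exact congrArg (fun q => some (Turing.TM2.stepAux q v S)) (h.prog x)

open Classical in
theorem step_of_calls_some {c : Cmd 𝒪 K} {e : Pos c → Option (Pos c₀)} {exit : Option (Pos c₀)}
    (h : Embedded c₀ input output c e exit) {x : Pos c} {A : 𝒪} {k : K}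
    (hx : calls c x = some (A, k)) (v : Option Bool) (S : K → List Bool) :
    (toMachine c₀ input output).step ⟨some (e x), v, S⟩ =
      some (Turing.TM2.stepAux (code c e exit x)
        (some (decide (S k ∈ (A : Language Bool)))) S) := by
  have hq := (h.query x).trans hx
  simp only [OracleTM.step, OracleTM.consult, hq]
  exact congrArg (fun q => some (Turing.TM2.stepAux q (some (decide (S k ∈ (A : Language Bool)))) S))
    (h.prog x)

/-- Induction on the run, for all embeddings and exit labels at once, since a subprogram is entered
with its own. The initial internal state is arbitrary because every test overwrites it before
branching. -/
theorem Runs.reachesIn {c : Cmd 𝒪 K} {S S' : K → List Bool} {t : ℕ} (h : Runs c S t S') :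
    ∀ {e : Pos c → Option (Pos c₀)} {exit : Option (Pos c₀)},
      Embedded c₀ input output c e exit → ∀ v, ∃ v',
        ReachesIn (toMachine c₀ input output) t ⟨some (e (entry c)), v, S⟩ ⟨some exit, v', S'⟩ := by
  induction h with
  | push k b S =>
    intro e exit hE v
    exact ⟨v, .of_step (step_of_calls_none hE (x := ()) rfl v S)⟩
  | pop k S =>
    intro e exit hE v
    exact ⟨v, .of_step (step_of_calls_none hE (x := ()) rfl v S)⟩
  | skip S =>
    intro e exit hE v
    exact ⟨v, .of_step (step_of_calls_none hE (x := ()) rfl v S)⟩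
  | @seq c d S S' S'' t t' _ _ ih1 ih2 =>
    intro e exit hE v
    obtain ⟨v', h1⟩ := ih1 (e := fun x => e (Sum.inl x)) (exit := e (Sum.inr (entry d)))
      ⟨fun x => hE.prog (Sum.inl x), fun x => hE.query (Sum.inl x)⟩ v
    obtain ⟨v'', h2⟩ := ih2 (e := fun x => e (Sum.inr x)) (exit := exit)
      ⟨fun x => hE.prog (Sum.inr x), fun x => hE.query (Sum.inr x)⟩ v'
    exact ⟨v'', h1.trans h2⟩
  | @ite_true k p c d S S' t hp _ ih =>
    intro e exit hE v
    obtain ⟨v', h1⟩ := ih (e := fun x => e (some (Sum.inl x))) (exit := exit)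
      ⟨fun x => hE.prog (some (Sum.inl x)), fun x => hE.query (some (Sum.inl x))⟩ (S k).head?
    refine ⟨v', (ReachesIn.trans (.of_step ?_) h1).mono (add_comm 1 t).le⟩
    refine (step_of_calls_none hE (x := none) rfl v S).trans ?_
    change some (cond (p (S k).head?) _ _) = _
    rw [hp]
    rfl
  | @ite_false k p c d S S' t hp _ ih =>
    intro e exit hE v
    obtain ⟨v', h1⟩ := ih (e := fun x => e (some (Sum.inr x))) (exit := exit)
      ⟨fun x => hE.prog (some (Sum.inr x)), fun x => hE.query (some (Sum.inr x))⟩ (S k).head?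
    refine ⟨v', (ReachesIn.trans (.of_step ?_) h1).mono (add_comm 1 t).le⟩
    refine (step_of_calls_none hE (x := none) rfl v S).trans ?_
    change some (cond (p (S k).head?) _ _) = _
    rw [hp]
    rfl
  | @loop_true k p c S S' S'' t t' hp _ _ ih1 ih2 =>
    intro e exit hE v
    -- The body of a loop is left through the loop head `e none`, where the test is repeated.
    obtain ⟨v', h1⟩ := ih1 (e := fun x => e (some x)) (exit := e none)
      ⟨fun x => hE.prog (some x), fun x => hE.query (some x)⟩ (S k).head?
    obtain ⟨v'', h2⟩ := ih2 hE v'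
    refine ⟨v'', (ReachesIn.trans (.of_step ?_) (h1.trans h2)).mono (add_comm 1 (t + t')).le⟩
    refine (step_of_calls_none hE (x := none) rfl v S).trans ?_
    change some (cond (p (S k).head?) _ _) = _
    rw [hp]
    rfl
  | @loop_false k p c S hp =>
    intro e exit hE v
    refine ⟨(S k).head?, .of_step ?_⟩
    refine (step_of_calls_none hE (x := none) rfl v S).trans ?_
    change some (cond (p (S k).head?) _ _) = _
    rw [hp]
    rfl
  | @ask_true A k c d S S' t hp _ ih =>
    intro e exit hE v
    obtain ⟨v', h1⟩ := ih (e := fun x => e (some (Sum.inl x))) (exit := exit)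
      ⟨fun x => hE.prog (some (Sum.inl x)), fun x => hE.query (some (Sum.inl x))⟩ (some true)
    refine ⟨v', (ReachesIn.trans (.of_step ?_) h1).mono (add_comm 1 t).le⟩
    refine (step_of_calls_some hE (x := none) rfl v S).trans ?_
    simp [code, jump, hp]
    rfl
  | @ask_false A k c d S S' t hp _ ih =>
    intro e exit hE v
    obtain ⟨v', h1⟩ := ih (e := fun x => e (some (Sum.inr x))) (exit := exit)
      ⟨fun x => hE.prog (some (Sum.inr x)), fun x => hE.query (some (Sum.inr x))⟩ (some false)
    refine ⟨v', (ReachesIn.trans (.of_step ?_) h1).mono (add_comm 1 t).le⟩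
    refine (step_of_calls_some hE (x := none) rfl v S).trans ?_
    simp [code, jump, hp]
    rfl
  | mono _ ht ih =>
    intro e exit hE v
    obtain ⟨v', h1⟩ := ih hE v
    exact ⟨v', h1.mono ht⟩

theorem Runs.decidesInTime {c : Cmd 𝒪 K} {L : Language Bool} {w : List Bool} {t : ℕ}
    {S : K → List Bool} (h : Runs c (fun k => if k = input then w else []) t S)
    (hS : (S output).head? = some true ↔ w ∈ L) :
    (toMachine c input output).DecidesInTime L w (t + 1) := by
  obtain ⟨v, h1⟩ := h.reachesIn (c₀ := c) (input := input) (output := output)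
    (e := some) (exit := none) ⟨fun _ => rfl, fun _ => rfl⟩ none
  -- The additional step is the one at label `none`, which reads the output letter and halts.
  obtain ⟨n, hn, e⟩ := h1.trans (c := ⟨none, (S output).head?, S⟩) (.of_step rfl)
  refine ⟨⟨none, (S output).head?, S⟩, ⟨⟨⟨n, e⟩, hn⟩⟩, rfl, ?_⟩
  · simpa [toMachine] using hS

end Simulation

end Cmd

end Language

end SLPComplexity

namespace SLPComplexity

/-! ### Subroutines -/

section Subroutines

namespace Cmd

infixr:60 " ⨾ " => Cmd.seq

/-- The test whether a stack is nonempty. -/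
def nonempty (o : Option Bool) : Bool := o.isSome

/-- The test whether the letter on top of a stack is `1`. -/
def topOne (o : Option Bool) : Bool := o == some true

variable {𝒪 : Set (Language Bool)} {K : Type} [DecidableEq K]

/-- Move the top letter of stack `k` to stack `l`. -/
def move (k l : K) : Cmd 𝒪 K :=
  .ite k topOne (.pop k ⨾ .push l true) (.pop k ⨾ .push l false)

theorem runs_move {k l : K} (hkl : k ≠ l) {S : K → List Bool} {b : Bool} {x : List Bool}
    (h : S k = b :: x) :
    Runs (move k l : Cmd 𝒪 K) S 3 (Function.update (Function.update S k x) l (b :: S l)) := by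
  cases b
  · refine (Runs.ite_false (by simp [h, topOne]) ((Runs.pop k S).seq (Runs.push l false _))).cast
      ?_ le_rfl
    simp [h, hkl.symm]
  · refine (Runs.ite_true (by simp [h, topOne]) ((Runs.pop k S).seq (Runs.push l true _))).cast
      ?_ le_rfl
    simp [h, hkl.symm]

/-- Move all letters of stack `k` to stack `l`. -/
def pour (k l : K) : Cmd 𝒪 K := .loop k nonempty (move k l)

theorem runs_pour {k l : K} (hkl : k ≠ l) (x : List Bool) {S : K → List Bool} (h : S k = x) :
    Runs (pour k l : Cmd 𝒪 K) S (4 * x.length + 1)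
      (Function.update (Function.update S k []) l (x.reverse ++ S l)) := by
  induction x generalizing S with
  | nil =>
    refine (Runs.loop_false (by simp [h, nonempty])).cast ?_ (by simp)
    have : Function.update S k [] = S := by rw [← h, Function.update_eq_self]
    simp [this]
  | cons b x ih =>
    refine (Runs.loop_true (by simp [h, nonempty]) (runs_move hkl h) (ih ?_)).cast ?_ ?_
    · simp [hkl]
    · funext j
      by_cases hl : j = l
      · subst hl; simp
      · by_cases hk : j = k
        · subst hk; simp [hkl]
        · simp [hl, hk]
    · simp only [List.length_cons]; omega

/-- Add one to the binary number on stack `k`, with the help of the empty stack `t`. -/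
def inc (k t : K) : Cmd 𝒪 K :=
  .loop k topOne (.pop k ⨾ .push t true) ⨾ .ite k nonempty (.pop k) .skip ⨾ .push k true ⨾
    .loop t nonempty (.pop t ⨾ .push k false)

theorem runs_loop_pop_ones {k t : K} (hkt : k ≠ t) (j : ℕ) {S : K → List Bool} {x : List Bool}
    (h : S k = List.replicate j true ++ x) (hx : x.head? ≠ some true) :
    Runs (.loop k topOne (.pop k ⨾ .push t true) : Cmd 𝒪 K) S (3 * j + 1)
      (Function.update (Function.update S k x) t (List.replicate j true ++ S t)) := by
  induction j generalizing S with
  | zero =>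
    have h' : S k = x := by simpa using h
    refine (Runs.loop_false (by simpa [h', topOne] using hx)).cast ?_ (by simp)
    simp [← h']
  | succ j ih =>
    refine (Runs.loop_true (by simp [h, topOne, List.replicate_succ])
      ((Runs.pop k S).seq (Runs.push t true _)) (ih ?_)).cast ?_ (by omega)
    · simp [hkt, h, List.replicate_succ]
    · funext l
      by_cases hl : l = t
      · subst hl
        simp [hkt.symm, List.replicate_succ', List.append_assoc]
      · by_cases hk : l = k
        · subst hk; simp [hkt]
        · simp [hl, hk]

theorem runs_loop_push_zeros {k t : K} (hkt : k ≠ t) (j : ℕ) {S : K → List Bool}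
    (h : S t = List.replicate j true) :
    Runs (.loop t nonempty (.pop t ⨾ .push k false) : Cmd 𝒪 K) S (3 * j + 1)
      (Function.update (Function.update S t []) k (List.replicate j false ++ S k)) := by
  induction j generalizing S with
  | zero =>
    have h' : S t = [] := by simpa using h
    refine (Runs.loop_false (by simp [h', nonempty])).cast ?_ (by simp)
    simp [← h']
  | succ j ih =>
    refine (Runs.loop_true (by simp [h, nonempty, List.replicate_succ])
      ((Runs.pop t S).seq (Runs.push k false _)) (ih ?_)).cast ?_ (by omega)
    · simp [hkt.symm, h, List.replicate_succ]
    · funext l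
      by_cases hl : l = t
      · subst hl
        simp [hkt.symm]
      · by_cases hk : l = k
        · subst hk; simp [hkt, List.replicate_succ', List.append_assoc]
        · simp [hl, hk]

/-- This is the carry: j counts the trailing ones of n. The crude bound j ≤ n suffices, since the
machine increments only instruction counts, which are linear in the input length. -/
theorem exists_bits_eq_replicate (n : ℕ) : ∃ (j : ℕ) (x : List Bool), j ≤ n ∧
    n.bits = List.replicate j true ++ x ∧ x.head? ≠ some true ∧
      (n + 1).bits = List.replicate j false ++ true :: x.tail := by
  induction n using Nat.strong_induction_on with
  | _ n ih =>
    rcases Nat.even_or_odd' n with ⟨q, rfl | rfl⟩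
    · refine ⟨0, (2 * q).bits, by omega, by simp, ?_, ?_⟩
      · rcases eq_or_ne q 0 with rfl | hq
        · simp
        · simp [Nat.bit0_bits q hq]
      · rw [Nat.bit1_bits]
        rcases eq_or_ne q 0 with rfl | hq
        · simp
        · simp [Nat.bit0_bits q hq]
    · obtain ⟨j, x, hj, h1, h2, h3⟩ := ih q (by omega)
      refine ⟨j + 1, x, by omega, ?_, h2, ?_⟩
      · rw [Nat.bit1_bits, h1, List.replicate_succ, List.cons_append]
      · rw [show 2 * q + 1 + 1 = 2 * (q + 1) by ring, Nat.bit0_bits _ (by omega), h3,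
          List.replicate_succ, List.cons_append]

theorem runs_inc {k t : K} (hkt : k ≠ t) {S : K → List Bool} {n : ℕ} (hk : S k = n.bits)
    (ht : S t = []) :
    Runs (inc k t : Cmd 𝒪 K) S (6 * n + 6) (Function.update S k (n + 1).bits) := by
  obtain ⟨j, x, hj, h1, h2, h3⟩ := exists_bits_eq_replicate n
  have hpop : ∀ S' : K → List Bool, S' k = x →
      Runs (.ite k nonempty (.pop k) .skip : Cmd 𝒪 K) S' 2 (Function.update S' k x.tail) := by
    intro S' hS'
    cases x with
    | nil =>
      refine (Runs.ite_false (by simp [hS', nonempty]) (Runs.skip _)).cast ?_ le_rfl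
      rw [List.tail_nil, ← hS', Function.update_eq_self]
    | cons b x =>
      refine (Runs.ite_true (by simp [hS', nonempty]) (Runs.pop _ _)).cast ?_ le_rfl
      simp [hS']
  refine ((runs_loop_pop_ones hkt j (hk.trans h1) h2).seq ((hpop _ ?_).seq
    ((Runs.push k true _).seq (runs_loop_push_zeros hkt j ?_)))).cast ?_ ?_
  · simp [hkt]
  · simp [hkt.symm, ht]
  · funext l
    by_cases hl : l = t
    · subst hl; simp [hkt.symm, ht]
    · by_cases hk : l = k
      · subst hk; simp [h3]
      · simp [hl, hk]
  · omega

/-- Write the self-delimiting code of the binary number on stack `k` to stack `r`, which holds a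
word in reverse order, with the help of the empty stack `t`. -/
def emit (k r t : K) : Cmd 𝒪 K :=
  .loop k nonempty (.ite k topOne (.push r true ⨾ .pop k ⨾ .push r true ⨾ .push t true)
    (.push r true ⨾ .pop k ⨾ .push r false ⨾ .push t false)) ⨾ .push r false ⨾ pour t k

theorem runs_emit_loop {k r t : K} (hkr : k ≠ r) (hkt : k ≠ t) (hrt : r ≠ t) (x : List Bool)
    {S : K → List Bool} (hk : S k = x) :
    Runs (.loop k nonempty (.ite k topOne (.push r true ⨾ .pop k ⨾ .push r true ⨾ .push t true)
        (.push r true ⨾ .pop k ⨾ .push r false ⨾ .push t false)) : Cmd 𝒪 K) S (6 * x.length + 1)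
      (Function.update (Function.update (Function.update S k []) r ((pairs x).reverse ++ S r)) t
        (x.reverse ++ S t)) := by
  induction x generalizing S with
  | nil =>
    refine (Runs.loop_false (by simp [hk, nonempty])).cast ?_ (by simp)
    have : Function.update S k [] = S := by rw [← hk, Function.update_eq_self]
    simp [this]
  | cons b x ih =>
    have hbody : ∃ S' : K → List Bool, S' = Function.update (Function.update (Function.update S k x)
        r (b :: true :: S r)) t (b :: S t) ∧
        Runs (.ite k topOne (.push r true ⨾ .pop k ⨾ .push r true ⨾ .push t true)
          (.push r true ⨾ .pop k ⨾ .push r false ⨾ .push t false) : Cmd 𝒪 K) S 5 S' := by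
      refine ⟨_, rfl, ?_⟩
      cases b
      · refine (Runs.ite_false (by simp [hk, topOne]) ((Runs.push r true _).seq
          ((Runs.pop k _).seq ((Runs.push r false _).seq (Runs.push t false _))))).cast ?_ le_rfl
        funext l
        by_cases hl : l = t
        · subst hl; simp [hkt.symm, hrt.symm]
        · by_cases hlr : l = r
          · subst hlr; simp [hrt, hkr.symm]
          · by_cases hlk : l = k
            · subst hlk; simp [hkr, hkt, hk]
            · simp [hl, hlr, hlk]
      · refine (Runs.ite_true (by simp [hk, topOne]) ((Runs.push r true _).seq
          ((Runs.pop k _).seq ((Runs.push r true _).seq (Runs.push t true _))))).cast ?_ le_rfl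
        funext l
        by_cases hl : l = t
        · subst hl; simp [hkt.symm, hrt.symm]
        · by_cases hlr : l = r
          · subst hlr; simp [hrt, hkr.symm]
          · by_cases hlk : l = k
            · subst hlk; simp [hkr, hkt, hk]
            · simp [hl, hlr, hlk]
    obtain ⟨S', hS', hrun⟩ := hbody
    refine (Runs.loop_true (by simp [hk, nonempty]) hrun (ih ?_)).cast ?_ ?_
    · simp [hS', hkr, hkt]
    · subst hS'
      funext l
      by_cases hl : l = t
      · subst hl; simp
      · by_cases hlr : l = r
        · subst hlr; simp [hrt]
        · by_cases hlk : l = k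
          · subst hlk; simp [hkr, hkt]
          · simp [hl, hlr, hlk]
    · simp only [List.length_cons]; omega

theorem length_bits_le (n : ℕ) : n.bits.length ≤ n := by
  rw [Nat.size_eq_bits_len]
  exact Nat.size_le.mpr Nat.lt_two_pow_self

theorem runs_emit {k r t : K} (hkr : k ≠ r) (hkt : k ≠ t) (hrt : r ≠ t) {S : K → List Bool} {n : ℕ}
    (hk : S k = n.bits) (ht : S t = []) :
    Runs (emit k r t : Cmd 𝒪 K) S (10 * n + 3)
      (Function.update S r ((encodeNat n).reverse ++ S r)) := by
  refine ((runs_emit_loop hkr hkt hrt n.bits hk).seq ((Runs.push r false _).seq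
    (runs_pour hkt.symm n.bits.reverse ?_))).cast ?_ ?_
  · simp [hrt.symm, ht]
  · funext l
    by_cases hl : l = t
    · subst hl; simp [hkt.symm, hrt.symm, ht]
    · by_cases hlr : l = r
      · subst hlr; simp [hrt, hkr.symm, encodeNat_eq]
      · by_cases hlk : l = k
        · subst hlk; simp [hkr, hkt, hk]
        · simp [hl, hlr, hlk]
  · have := length_bits_le n
    simp only [List.length_reverse]
    omega

end Cmd

end Subroutines

end SLPComplexity

namespace SLPComplexity

/-! ### The program for sums of three squares -/

section ThreeSquaresProgram

open Cmd

/-! ### Stacks and executions -/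

/-- The stacks of the machine: the input and oracle questions (`W`), the extended program in reverse
order (`R`), the index of the last instruction (`I`) and of the input's last instruction (`M`) in
binary, a unary counter (`C`), scratch space and output (`T`), and two copies of the exponent of four
with the most significant digit on top (`A`, `B`). -/
inductive Reg
  | W | R | I | M | C | T | A | B
  deriving DecidableEq

instance : Fintype Reg where
  elems := {.W, .R, .I, .M, .C, .T, .A, .B}
  complete x := by cases x <;> decide

/-- The contents of the stacks. -/
structure Mem where
  w : List Bool
  r : List Bool
  i : List Bool
  m : List Bool
  c : List Bool
  t : List Bool
  a : List Bool
  b : List Bool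

namespace Mem

/-- The contents of a stack. -/
def get (s : Mem) : Reg → List Bool
  | .W => s.w
  | .R => s.r
  | .I => s.i
  | .M => s.m
  | .C => s.c
  | .T => s.t
  | .A => s.a
  | .B => s.b

/-- Replace the contents of a stack. -/
def set (s : Mem) (k : Reg) (x : List Bool) : Mem :=
  match k with
  | .W => { s with w := x }
  | .R => { s with r := x }
  | .I => { s with i := x }
  | .M => { s with m := x }
  | .C => { s with c := x }
  | .T => { s with t := x }
  | .A => { s with a := x }
  | .B => { s with b := x }

/-- On records with named fields, different orders of updates agree by computation, so most
configurations can be compared by `rfl`. -/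
theorem update_get (s : Mem) (k : Reg) (x : List Bool) :
    Function.update s.get k x = (s.set k x).get := by
  funext l
  cases k <;> cases l <;> rfl

end Mem

/-- The oracles. -/
abbrev oracles : Set (Language Bool) := {Div2SLP, PosSLP}

/-- The oracle for divisibility by powers of two. -/
def div2 : oracles := ⟨Div2SLP, Or.inl rfl⟩

/-- The oracle for positivity. -/
def pos : oracles := ⟨PosSLP, Or.inr rfl⟩

/-- `Exec c s t s'`: the program `c` leads from `s` to `s'` in at most `t` steps. -/
def Exec (c : Cmd oracles Reg) (s : Mem) (t : ℕ) (s' : Mem) : Prop := Runs c s.get t s'.get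

namespace Exec

variable {c d : Cmd oracles Reg} {s s' s'' : Mem} {t t' : ℕ} {k l r : Reg}

theorem mono (h : Exec c s t s') (ht : t ≤ t') : Exec c s t' s' := Runs.mono h ht

theorem push (k : Reg) (b : Bool) (s : Mem) : Exec (.push k b) s 1 (s.set k (b :: s.get k)) := by
  rw [Exec, ← Mem.update_get]
  exact Runs.push k b _

theorem pop (k : Reg) (s : Mem) : Exec (.pop k) s 1 (s.set k (s.get k).tail) := by
  rw [Exec, ← Mem.update_get]
  exact Runs.pop k _

theorem skip (s : Mem) : Exec .skip s 1 s := Runs.skip _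

theorem seq (h : Exec c s t s') (h' : Exec d s' t' s'') : Exec (c ⨾ d) s (t + t') s'' :=
  Runs.seq h h'

theorem ite_true {p : Option Bool → Bool} (hp : p (s.get k).head? = true) (h : Exec c s t s') :
    Exec (.ite k p c d) s (t + 1) s' := Runs.ite_true hp h

theorem ite_false {p : Option Bool → Bool} (hp : p (s.get k).head? = false) (h : Exec d s t s') :
    Exec (.ite k p c d) s (t + 1) s' := Runs.ite_false hp h

theorem loop_true {p : Option Bool → Bool} (hp : p (s.get k).head? = true) (h : Exec c s t s')
    (h' : Exec (.loop k p c) s' t' s'') : Exec (.loop k p c) s (t + t' + 1) s'' :=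
  Runs.loop_true hp h h'

theorem loop_false {p : Option Bool → Bool} (hp : p (s.get k).head? = false) :
    Exec (.loop k p c) s 1 s := Runs.loop_false hp

theorem ask_true {A : oracles} (hA : s.get k ∈ (A : Language Bool)) (h : Exec c s t s') :
    Exec (.ask A k c d) s (t + 1) s' := Runs.ask_true hA h

theorem ask_false {A : oracles} (hA : s.get k ∉ (A : Language Bool)) (h : Exec d s t s') :
    Exec (.ask A k c d) s (t + 1) s' := Runs.ask_false hA h

theorem move (hkl : k ≠ l) {b : Bool} {x : List Bool} (h : s.get k = b :: x) :
    Exec (move k l) s 3 ((s.set k x).set l (b :: s.get l)) := by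
  rw [Exec, ← Mem.update_get, ← Mem.update_get]
  exact runs_move hkl h

theorem pour (hkl : k ≠ l) {x : List Bool} (h : s.get k = x) :
    Exec (pour k l) s (4 * x.length + 1) ((s.set k []).set l (x.reverse ++ s.get l)) := by
  rw [Exec, ← Mem.update_get, ← Mem.update_get]
  exact runs_pour hkl x h

theorem inc (hk : k ≠ .T) {n : ℕ} (h : s.get k = n.bits) (ht : s.t = []) :
    Exec (inc k .T) s (6 * n + 6) (s.set k (n + 1).bits) := by
  rw [Exec, ← Mem.update_get]
  exact runs_inc hk h ht

theorem emit (hk : k ≠ .R) (hk' : k ≠ .T) {n : ℕ} (h : s.get k = n.bits) (ht : s.t = []) :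
    Exec (emit k .R .T) s (10 * n + 3) (s.set .R ((encodeNat n).reverse ++ s.r)) := by
  rw [Exec, ← Mem.update_get]
  exact runs_emit hk hk' (by decide) h ht

end Exec

/-! #### Reading the input -/

/-- Move the code of a natural number from `W` to `R`. -/
def moveNat : Cmd oracles Reg :=
  .loop .W topOne (move .W .R ⨾ move .W .R) ⨾ move .W .R

theorem exec_moveNat (x r i m c t a b : List Bool) (n : ℕ) :
    Exec moveNat ⟨encodeNat n ++ x, r, i, m, c, t, a, b⟩ (4 * (encodeNat n).length)
      ⟨x, (encodeNat n).reverse ++ r, i, m, c, t, a, b⟩ := by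
  have key : ∀ (l r : List Bool), Exec (.loop .W topOne (move .W .R ⨾ move .W .R))
      ⟨pairs l ++ false :: x, r, i, m, c, t, a, b⟩ (7 * l.length + 1)
      ⟨false :: x, (pairs l).reverse ++ r, i, m, c, t, a, b⟩ := by
    intro l
    induction l with
    | nil => exact fun r => Exec.loop_false rfl
    | cons d l ih =>
      intro r
      have h1 : Exec (move .W .R) ⟨true :: d :: (pairs l ++ false :: x), r, i, m, c, t, a, b⟩ 3
          ⟨d :: (pairs l ++ false :: x), true :: r, i, m, c, t, a, b⟩ :=
        Exec.move (by decide) rfl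
      have h2 : Exec (move .W .R) ⟨d :: (pairs l ++ false :: x), true :: r, i, m, c, t, a, b⟩ 3
          ⟨pairs l ++ false :: x, d :: true :: r, i, m, c, t, a, b⟩ :=
        Exec.move (by decide) rfl
      refine cast ?_ ((Exec.loop_true rfl (h1.seq h2) (ih (d :: true :: r))).mono
        (show _ ≤ 7 * (l.length + 1) + 1 by omega))
      simp
  have hlen : ∀ l : List Bool, (pairs l).length = 2 * l.length := by
    intro l
    induction l with
    | nil => rfl
    | cons d l ih => simp only [pairs_cons, List.length_cons, ih]; omega
  rw [encodeNat_eq, List.append_assoc, List.reverse_append]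
  refine ((key n.bits r).seq (Exec.move (by decide) rfl)).mono ?_
  simp only [List.length_append, List.length_singleton, hlen]
  omega

/-- Move a straight-line program from `W` to `R` and count its instructions in `I`, `M` and `C`. -/
def parse : Cmd oracles Reg :=
  .loop .W nonempty (move .W .R ⨾ move .W .R ⨾ moveNat ⨾ moveNat ⨾ inc .I .T ⨾ inc .M .T ⨾
    .push .C true)

theorem exec_parse (L : List Instr) (X : ℕ) : ∀ (r c a b : List Bool) (i : ℕ), i + L.length ≤ X →
    Exec parse ⟨encodeInstrs L, r, i.bits, i.bits, c, [], a, b⟩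
      (L.length * (12 * X + 20) + 4 * (encodeInstrs L).length + 1)
      ⟨[], (encodeInstrs L).reverse ++ r, (i + L.length).bits, (i + L.length).bits,
        List.replicate L.length true ++ c, [], a, b⟩ := by
  induction L with
  | nil => exact fun r c a b i _ => (Exec.loop_false rfl).mono (by simp)
  | cons I L ih =>
    intro r c a b i hX
    obtain ⟨o, j, k⟩ := I
    rw [List.length_cons] at hX
    obtain ⟨d, d', hd⟩ : ∃ d d', encodeOp o = [d, d'] := by cases o <;> exact ⟨_, _, rfl⟩
    have e : encodeInstrs (⟨o, j, k⟩ :: L) =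
        d :: d' :: (encodeNat j ++ (encodeNat k ++ encodeInstrs L)) := by
      simp [encodeInstrs_cons, encodeInstr, hd]
    have h1 : Exec (move .W .R)
        ⟨d :: d' :: (encodeNat j ++ (encodeNat k ++ encodeInstrs L)), r, i.bits, i.bits, c, [], a, b⟩
        3 ⟨d' :: (encodeNat j ++ (encodeNat k ++ encodeInstrs L)), d :: r, i.bits, i.bits, c, [], a,
          b⟩ := Exec.move (by decide) rfl
    have h2 : Exec (move .W .R)
        ⟨d' :: (encodeNat j ++ (encodeNat k ++ encodeInstrs L)), d :: r, i.bits, i.bits, c, [], a, b⟩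
        3 ⟨encodeNat j ++ (encodeNat k ++ encodeInstrs L), d' :: d :: r, i.bits, i.bits, c, [], a,
          b⟩ := Exec.move (by decide) rfl
    have h3 := (exec_moveNat (encodeNat k ++ encodeInstrs L) (d' :: d :: r) i.bits i.bits c [] a b
      j).seq ((exec_moveNat (encodeInstrs L) _ i.bits i.bits c [] a b k).seq
      ((Exec.inc (k := .I) (by decide) rfl rfl).seq ((Exec.inc (k := .M) (n := i) (by decide) rfl
      rfl).seq (Exec.push .C true _))))
    rw [e]
    refine cast ?_ ((Exec.loop_true rfl (h1.seq (h2.seq h3)) (ih ((encodeNat k).reverse ++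
      ((encodeNat j).reverse ++ d' :: d :: r)) (true :: c) a b (i + 1) (by omega))).mono ?_
      (t' := (L.length + 1) * (12 * X + 20) +
        4 * (d :: d' :: (encodeNat j ++ (encodeNat k ++ encodeInstrs L))).length + 1))
    · simp [parse, List.replicate_succ', Nat.add_assoc, Nat.add_comm 1 L.length]
    -- Each increment is charged at its maximal cost 6X + 6, which gives the 12X per instruction.
    · simp only [List.length_append, List.length_cons]
      rw [add_mul]
      omega

/-! #### Finding the exponent of four -/

/-- Remove the padding zeros from the code of a natural number on `W`, whose number is kept in
unary on `T`. -/
def unpad : Cmd oracles Reg :=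
  .loop .T nonempty (.pop .T ⨾ .push .C true ⨾ .pop .W ⨾ .pop .W)

/-- Double the number coded on `W` and add one, add as many zero digits as the unary counter `C`
says. -/
def pad : Cmd oracles Reg :=
  .push .W true ⨾ .push .W true ⨾
    .loop .C nonempty (.pop .C ⨾ .push .T true ⨾ .push .W false ⨾ .push .W true)

/-- Replace the last digit `1` of the number coded on `W` by `0`. -/
def clearBit : Cmd oracles Reg :=
  .pop .W ⨾ .pop .W ⨾ .ite .W topOne (.push .W false ⨾ .push .W true) .skip

/-- Find the digits of the largest exponent `a` such that `4 ^ a` divides the value of the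
straight-line program on `W`, from the most significant digit on. -/
def search : Cmd oracles Reg :=
  .loop .C nonempty (pad ⨾ .ask div2 .W unpad (unpad ⨾ clearBit) ⨾ .pop .C)

theorem exec_unpad (q : ℕ) : ∀ x r i m c a b : List Bool,
    Exec unpad ⟨pairs (List.replicate q false) ++ x, r, i, m, c, List.replicate q true, a, b⟩
      (5 * q + 1) ⟨x, r, i, m, List.replicate q true ++ c, [], a, b⟩ := by
  induction q with
  | zero => exact fun x r i m c a b => Exec.loop_false rfl
  | succ q ih =>
    intro x r i m c a b
    refine cast ?_ ((Exec.loop_true (c := .pop .T ⨾ .push .C true ⨾ .pop .W ⨾ .pop .W) rfl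
      ((Exec.pop .T ⟨pairs (List.replicate (q + 1) false) ++ x, r, i, m, c,
        List.replicate (q + 1) true, a, b⟩).seq ((Exec.push .C true _).seq
        ((Exec.pop .W _).seq (Exec.pop .W _)))) (ih x r i m (true :: c) a b)).mono
        (show _ ≤ 5 * (q + 1) + 1 by omega))
    rw [List.replicate_succ' (n := q) (a := true)]
    simp [unpad]

theorem exec_pad (q u : ℕ) (w r i m a b : List Bool) :
    Exec pad ⟨encodeNat u ++ w, r, i, m, List.replicate q true, [], a, b⟩ (5 * q + 3)
      ⟨pairs (List.replicate q false) ++ (encodeNat (2 * u + 1) ++ w), r, i, m, [],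
        List.replicate q true, a, b⟩ := by
  have key : ∀ (q : ℕ) (x t : List Bool),
      Exec (.loop .C nonempty (.pop .C ⨾ .push .T true ⨾ .push .W false ⨾ .push .W true))
        ⟨x, r, i, m, List.replicate q true, t, a, b⟩ (5 * q + 1)
        ⟨pairs (List.replicate q false) ++ x, r, i, m, [], List.replicate q true ++ t, a, b⟩ := by
    intro q
    induction q with
    | zero => exact fun x t => Exec.loop_false rfl
    | succ q ih =>
      intro x t
      refine cast ?_ ((Exec.loop_true
        (c := .pop .C ⨾ .push .T true ⨾ .push .W false ⨾ .push .W true) rfl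
        ((Exec.pop .C ⟨x, r, i, m, List.replicate (q + 1) true, t, a, b⟩).seq
        ((Exec.push .T true _).seq ((Exec.push .W false _).seq (Exec.push .W true _))))
        (ih (true :: false :: x) (true :: t))).mono (show _ ≤ 5 * (q + 1) + 1 by omega))
      rw [List.replicate_succ' (n := q), List.replicate_succ' (n := q)]
      simp [pairs_append]
  have e : true :: true :: (encodeNat u ++ w) = encodeNat (2 * u + 1) ++ w := by
    rw [encodeNat_eq, encodeNat_eq, Nat.bit1_bits]; rfl
  refine cast ?_ (((Exec.push .W true ⟨encodeNat u ++ w, r, i, m, List.replicate q true, [], a,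
    b⟩).seq ((Exec.push .W true _).seq (key q _ []))).mono (show _ ≤ 5 * q + 3 by omega))
  rw [List.append_nil, ← e]
  rfl

theorem exec_clearBit (u : ℕ) (w r i m c t a b : List Bool) :
    Exec clearBit ⟨encodeNat (2 * u + 1) ++ w, r, i, m, c, t, a, b⟩ 5
      ⟨encodeNat (2 * u) ++ w, r, i, m, c, t, a, b⟩ := by
  have e : encodeNat (2 * u + 1) ++ w = true :: true :: (encodeNat u ++ w) := by
    rw [encodeNat_eq, encodeNat_eq, Nat.bit1_bits]; rfl
  rw [e]
  refine ((Exec.pop .W ⟨true :: true :: (encodeNat u ++ w), r, i, m, c, t, a, b⟩).seq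
    ((Exec.pop .W _).seq (?_ : Exec _ ⟨encodeNat u ++ w, r, i, m, c, t, a, b⟩ 3 _)))
  -- Zero has no digits, so for u = 0 no digit may be put back: codes have no leading zeros.
  rcases Nat.eq_zero_or_pos u with rfl | hu
  · exact (Exec.ite_false rfl (Exec.skip _)).mono (by norm_num)
  · obtain ⟨d, l, hl⟩ : ∃ d l, u.bits = d :: l := by
      cases h : u.bits with
      | nil => exact absurd (bits_inj (n := 0) (by simpa using h)) hu.ne'
      | cons d l => exact ⟨d, l, rfl⟩
    have e2 : encodeNat (2 * u) ++ w = true :: false :: (encodeNat u ++ w) := by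
      rw [encodeNat_eq, encodeNat_eq, Nat.bit0_bits _ hu.ne']; rfl
    rw [e2]
    refine Exec.ite_true ?_ ((Exec.push .W false _).seq (Exec.push .W true _))
    simp [Mem.get, encodeNat_eq, hl, topOne]

/-- Digits come least significant first, so zeros in front multiply by powers of two. For u = 0 they
would be forbidden leading zeros. -/
theorem pairs_replicate_append_encodeNat (q u : ℕ) (hu : u ≠ 0) :
    pairs (List.replicate q false) ++ encodeNat u = encodeNat (u * 2 ^ q) := by
  induction q with
  | zero => simp
  | succ q ih =>
    rw [List.replicate_succ, pairs_cons, List.cons_append, List.cons_append, ih,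
      show u * 2 ^ (q + 1) = 2 * (u * 2 ^ q) by ring, encodeNat_eq, encodeNat_eq,
      Nat.bit0_bits _ (by positivity)]
    rfl

/-- Bisection: for N ≠ 0 the exponent a of four in N satisfies u 2^c ≤ a < (u + 1) 2^c, and u
collects the leading digits of a. For N = 0 all answers are positive and any v will do. -/
theorem exec_search {L : List Instr} (hL : WellFormed L) {N : ℤ}
    (hN : (values L).getD L.length 0 = N) (r i m a b : List Bool) (X : ℕ) (c : ℕ) :
    ∀ u : ℕ, c ≤ X → (4 : ℤ) ^ (u * 2 ^ c) ∣ N → (N ≠ 0 → ¬ (4 : ℤ) ^ ((u + 1) * 2 ^ c) ∣ N) →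
    ∃ v : ℕ, (4 : ℤ) ^ v ∣ N ∧ (N ≠ 0 → ¬ (4 : ℤ) ^ (v + 1) ∣ N) ∧
      v.bits.length ≤ u.bits.length + c ∧
      Exec search ⟨encodeNat u ++ encodeInstrs L, r, i, m, List.replicate c true, [], a, b⟩
        (c * (10 * X + 15) + 1)
        ⟨encodeNat v ++ encodeInstrs L, r, i, m, [], [], a, b⟩ := by
  induction c with
  | zero =>
    intro u _ h1 h2
    exact ⟨u, by simpa using h1, by simpa using h2, by simp, (Exec.loop_false rfl).mono (by simp)⟩
  | succ c ih =>
    intro u hX h1 h2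
    have hq : pairs (List.replicate (c + 1) false) ++ (encodeNat (2 * u + 1) ++ encodeInstrs L) =
        encodeNat ((2 * u + 1) * 2 ^ (c + 1)) ++ encodeInstrs L := by
      rw [← List.append_assoc, pairs_replicate_append_encodeNat _ _ (by omega)]
    -- The candidate exponent of four is (2u + 1) 2^c. Padding with c + 1 zeros rather than c
    -- doubles it, which turns the power of four into the power of two that the oracle expects.
    have hmem : pairs (List.replicate (c + 1) false) ++ (encodeNat (2 * u + 1) ++ encodeInstrs L) ∈
        Div2SLP ↔ (4 : ℤ) ^ ((2 * u + 1) * 2 ^ c) ∣ N := by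
      rw [hq, encodeNat_append_mem_Div2SLP hL, hN, show (4 : ℤ) = 2 ^ 2 by norm_num, ← pow_mul,
        show (2 * u + 1) * 2 ^ (c + 1) = 2 * ((2 * u + 1) * 2 ^ c) by ring]
    have hpad := exec_pad (c + 1) u (encodeInstrs L) r i m a b
    have hunpad := exec_unpad (c + 1) (encodeNat (2 * u + 1) ++ encodeInstrs L) r i m [] a b
    rw [List.append_nil] at hunpad
    have hlen : ((2 * u).bits).length ≤ u.bits.length + 1 := by
      rcases eq_or_ne u 0 with rfl | hu
      · simp
      · rw [Nat.bit0_bits _ hu]; simp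
    by_cases hd : (4 : ℤ) ^ ((2 * u + 1) * 2 ^ c) ∣ N
    · obtain ⟨v, hv1, hv2, hv3, hv4⟩ := ih (2 * u + 1) (by omega) hd (fun h0 => by
        rw [show (2 * u + 1 + 1) * 2 ^ c = (u + 1) * 2 ^ (c + 1) by ring]; exact h2 h0)
      refine ⟨v, hv1, hv2, hv3.trans ?_, ?_⟩
      · rw [Nat.bit1_bits, List.length_cons]; omega
      · refine (Exec.loop_true rfl (hpad.seq ((Exec.ask_true (hmem.mpr hd) hunpad).seq
          (Exec.pop .C _))) hv4).mono ?_
        rw [add_mul]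
        omega
    · obtain ⟨v, hv1, hv2, hv3, hv4⟩ := ih (2 * u) (by omega) (by
        rw [show 2 * u * 2 ^ c = u * 2 ^ (c + 1) by ring]; exact h1) (fun _ => hd)
      refine ⟨v, hv1, hv2, hv3.trans (by omega), ?_⟩
      refine (Exec.loop_true rfl (hpad.seq ((Exec.ask_false (fun h => hd (hmem.mp h))
        (hunpad.seq (exec_clearBit u _ r i m _ [] a b))).seq (Exec.pop .C _))) hv4).mono ?_
      rw [add_mul]
      omega

end ThreeSquaresProgram

end SLPComplexity

namespace SLPComplexity

section ThreeSquaresProgram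

open Cmd

/-! #### Extending the program -/

/-- Move the digits of the number coded on `W` to `A` and `B`. -/
def extract : Cmd oracles Reg :=
  .loop .W topOne (.pop .W ⨾ .ite .W topOne (.pop .W ⨾ .push .A true ⨾ .push .B true)
    (.pop .W ⨾ .push .A false ⨾ .push .B false)) ⨾ .pop .W

theorem exec_extract (v : ℕ) (w r i m c t : List Bool) :
    Exec extract ⟨encodeNat v ++ w, r, i, m, c, t, [], []⟩ (6 * v.bits.length + 2)
      ⟨w, r, i, m, c, t, v.bits.reverse, v.bits.reverse⟩ := by
  have key : ∀ l a b : List Bool, Exec (.loop .W topOne (.pop .W ⨾ .ite .W topOne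
      (.pop .W ⨾ .push .A true ⨾ .push .B true) (.pop .W ⨾ .push .A false ⨾ .push .B false)))
      ⟨pairs l ++ false :: w, r, i, m, c, t, a, b⟩ (6 * l.length + 1)
      ⟨false :: w, r, i, m, c, t, l.reverse ++ a, l.reverse ++ b⟩ := by
    intro l
    induction l with
    | nil => exact fun a b => Exec.loop_false rfl
    | cons d l ih =>
      intro a b
      have h : Exec (.ite .W topOne (.pop .W ⨾ .push .A true ⨾ .push .B true)
          (.pop .W ⨾ .push .A false ⨾ .push .B false))
          ⟨d :: (pairs l ++ false :: w), r, i, m, c, t, a, b⟩ 4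
          ⟨pairs l ++ false :: w, r, i, m, c, t, d :: a, d :: b⟩ := by
        cases d
        · exact Exec.ite_false rfl ((Exec.pop .W _).seq ((Exec.push .A false _).seq
            (Exec.push .B false _)))
        · exact Exec.ite_true rfl ((Exec.pop .W _).seq ((Exec.push .A true _).seq
            (Exec.push .B true _)))
      refine cast ?_ ((Exec.loop_true rfl ((Exec.pop .W
        ⟨true :: d :: (pairs l ++ false :: w), r, i, m, c, t, a, b⟩).seq h)
        (ih (d :: a) (d :: b))).mono (show _ ≤ 6 * (l.length + 1) + 1 by omega))
      simp
  have h := key v.bits [] []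
  rw [List.append_nil] at h
  rw [encodeNat_eq, List.append_assoc]
  exact h.seq (Exec.pop .W _)

/-- Write the code of an operation to `R`. -/
def emitOp : Op → Cmd oracles Reg
  | .add => .push .R false ⨾ .push .R false
  | .sub => .push .R false ⨾ .push .R true
  | .mul => .push .R true ⨾ .push .R false

theorem exec_emitOp (o : Op) (w r i m c t a b : List Bool) :
    Exec (emitOp o) ⟨w, r, i, m, c, t, a, b⟩ 2
      ⟨w, (encodeOp o).reverse ++ r, i, m, c, t, a, b⟩ := by
  cases o
  · exact (Exec.push .R false _).seq (Exec.push .R false _)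
  · exact (Exec.push .R false _).seq (Exec.push .R true _)
  · exact (Exec.push .R true _).seq (Exec.push .R false _)

/-- Append the instruction that applies an operation to the last number and itself. -/
def extend (o : Op) : Cmd oracles Reg :=
  emitOp o ⨾ emit .I .R .T ⨾ emit .I .R .T ⨾ inc .I .T

theorem exec_extend (o : Op) (L : List Instr) (i : ℕ) (w m c a b : List Bool) :
    Exec (extend o) ⟨w, (encodeInstrs L).reverse, i.bits, m, c, [], a, b⟩ (26 * i + 14)
      ⟨w, (encodeInstrs (L ++ [⟨o, i, i⟩])).reverse, (i + 1).bits, m, c, [], a, b⟩ := by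
  have h1 := exec_emitOp o w (encodeInstrs L).reverse i.bits m c [] a b
  refine cast ?_ ((h1.seq ((Exec.emit (k := .I) (by decide) (by decide) rfl rfl).seq
    ((Exec.emit (k := .I) (n := i) (by decide) (by decide) rfl rfl).seq
    (Exec.inc (k := .I) (n := i) (by decide) rfl rfl)))).mono (show _ ≤ 26 * i + 14 by omega))
  simp [extend, Mem.set, encodeInstrs_append, encodeInstrs_cons, encodeInstr]

/-- Extend the program by the computation of `4 ^ a`, where `a` is given on `A`. -/
def horner : Cmd oracles Reg :=
  .loop .A nonempty (extend .mul ⨾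
    .ite .A topOne (.pop .A ⨾ extend .add ⨾ extend .add) (.pop .A))

/-- Digits are read from the most significant one. Squaring doubles the exponent u of 4^u, and a
digit 1 adds two doublings of the value, that is a factor 4; hence the three instructions per digit
in the bound. -/
theorem exec_horner {m : ℕ} {N : ℤ} (X : ℕ) (w mm c b : List Bool) (l : List Bool) :
    ∀ (L : List Instr) (i u : ℕ), Computes L i (4 ^ u) m N → i + 3 * l.length ≤ X →
    ∃ (L' : List Instr) (i' : ℕ),
      Computes L' i' (4 ^ l.foldl (fun u d => Nat.bit d u) u) m N ∧ i' ≤ X ∧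
      Exec horner ⟨w, (encodeInstrs L).reverse, i.bits, mm, c, [], l, b⟩
        (l.length * (78 * X + 50) + 1)
        ⟨w, (encodeInstrs L').reverse, i'.bits, mm, c, [], [], b⟩ := by
  induction l with
  | nil =>
    exact fun L i u h hX => ⟨L, i, h, by simpa using hX, (Exec.loop_false rfl).mono (by simp)⟩
  | cons d l ih =>
    intro L i u h hX
    rw [List.length_cons] at hX
    have h1 := h.concat_last .mul
    have r1 := exec_extend .mul L i w mm c (d :: l) b
    cases d
    · have e : Op.mul.eval ((4 : ℤ) ^ u) (4 ^ u) = 4 ^ Nat.bit false u := by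
        rw [Op.eval, ← pow_add, Nat.bit_val]
        congr 1
        simp only [Bool.toNat_false]
        omega
      rw [e] at h1
      obtain ⟨L', i', hL', hi', r2⟩ := ih _ _ _ h1 (by omega)
      refine ⟨L', i', hL', hi', (Exec.loop_true rfl
        (r1.seq (Exec.ite_false rfl (Exec.pop .A _))) r2).mono ?_⟩
      rw [List.length_cons, add_mul]
      omega
    · have h2 := (h1.concat_last .add).concat_last .add
      have e : Op.add.eval (Op.add.eval (Op.mul.eval ((4 : ℤ) ^ u) (4 ^ u))
          (Op.mul.eval ((4 : ℤ) ^ u) (4 ^ u))) (Op.add.eval (Op.mul.eval ((4 : ℤ) ^ u) (4 ^ u))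
          (Op.mul.eval ((4 : ℤ) ^ u) (4 ^ u))) = 4 ^ Nat.bit true u := by
        rw [Nat.bit_val]
        simp only [Op.eval, Bool.toNat_true]
        rw [pow_succ, pow_mul', pow_two]
        ring
      rw [e] at h2
      obtain ⟨L', i', hL', hi', r2⟩ := ih _ _ _ h2 (by omega)
      have r3 := (exec_extend .add (L ++ [⟨.mul, i, i⟩]) (i + 1) w mm c l b).seq
        (exec_extend .add _ (i + 1 + 1) w mm c l b)
      refine ⟨L', i', hL', hi', (Exec.loop_true rfl
        (r1.seq (Exec.ite_true rfl ((Exec.pop .A _).seq r3))) r2).mono ?_⟩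
      rw [List.length_cons, add_mul]
      omega

/-- Append `s = 1`, the start of the computation of `4 ^ a`. -/
def start : Cmd oracles Reg :=
  emitOp .mul ⨾ .push .R false ⨾ .push .R false ⨾ inc .I .T

theorem exec_start (L : List Instr) (i : ℕ) (w m c a b : List Bool) :
    Exec start ⟨w, (encodeInstrs L).reverse, i.bits, m, c, [], a, b⟩ (6 * i + 10)
      ⟨w, (encodeInstrs (L ++ [⟨.mul, 0, 0⟩])).reverse, (i + 1).bits, m, c, [], a, b⟩ := by
  have h1 := exec_emitOp .mul w (encodeInstrs L).reverse i.bits m c [] a b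
  refine cast ?_ ((h1.seq ((Exec.push .R false _).seq ((Exec.push .R false _).seq
    (Exec.inc (k := .I) (n := i) (by decide) rfl rfl)))).mono (show _ ≤ 6 * i + 10 by omega))
  simp [start, Mem.set, Mem.get, encodeInstrs_append, encodeInstrs_cons, encodeInstr, encodeNat]

/-- Append the computation of `s * (N + s)`, where `s` is the last number, and `N` the one with the
index on `M`. -/
def combine : Cmd oracles Reg :=
  emitOp .add ⨾ emit .M .R .T ⨾ emit .I .R .T ⨾
    emitOp .mul ⨾ emit .I .R .T ⨾ inc .I .T ⨾ emit .I .R .T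

theorem exec_combine (L : List Instr) (i m : ℕ) (w c a b : List Bool) :
    Exec combine ⟨w, (encodeInstrs L).reverse, i.bits, m.bits, c, [], a, b⟩ (36 * i + 10 * m + 32)
      ⟨w, (encodeInstrs (L ++ [⟨.add, m, i⟩] ++ [⟨.mul, i, i + 1⟩])).reverse, (i + 1).bits, m.bits,
        c, [], a, b⟩ := by
  have h1 := exec_emitOp .add w (encodeInstrs L).reverse i.bits m.bits c [] a b
  have h2 := h1.seq ((Exec.emit (k := .M) (n := m) (by decide) (by decide) rfl rfl).seq
    ((Exec.emit (k := .I) (n := i) (by decide) (by decide) rfl rfl).seq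
    ((exec_emitOp .mul _ _ _ _ _ _ _ _).seq
    ((Exec.emit (k := .I) (n := i) (by decide) (by decide) rfl rfl).seq
    ((Exec.inc (k := .I) (n := i) (by decide) rfl rfl).seq
    (Exec.emit (k := .I) (n := i + 1) (by decide) (by decide) rfl rfl))))))
  refine cast ?_ (h2.mono (show _ ≤ 36 * i + 10 * m + 32 by omega))
  simp [combine, Mem.set, encodeInstrs_append, encodeInstrs_cons, encodeInstr]

theorem getD_values_zero (L : List Instr) : (values L).getD 0 0 = 1 := by
  induction L using List.reverseRecOn with
  | nil => rfl
  | append_singleton L I ih => rw [getD_values_concat_of_le _ _ (Nat.zero_le _), ih]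

/-- N + s alone would call for the exponent 2a + 3. The additional factor s = 4^a changes it to 4a +
3, whose digits are 1, 1 followed by those of a, so no carry arises in `prepend`. -/
theorem Computes.combine {L : List Instr} {i m : ℕ} {s N : ℤ} (h : Computes L i s m N) :
    Computes (L ++ [⟨.add, m, i⟩] ++ [⟨.mul, i, i + 1⟩]) (i + 2) (s * (N + s)) m N := by
  have h1 := h.concat ⟨.add, m, i⟩ h.le le_rfl
  have h2 := h1.concat ⟨.mul, i, i + 1⟩ (Nat.le_succ i) le_rfl
  simp only [h1.last] at h2
  rw [getD_values_concat_of_le _ _ h.length_eq.ge, h.last, h.mth] at h2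
  exact h2

theorem length_encodeNat_le (n : ℕ) : (encodeNat n).length ≤ 2 * n + 1 := by
  have h : ∀ l : List Bool, (pairs l).length = 2 * l.length := by
    intro l
    induction l with
    | nil => rfl
    | cons d l ih => simp only [pairs_cons, List.length_cons, ih]; omega
  have := length_bits_le n
  rw [encodeNat_eq, List.length_append, h, List.length_singleton]
  omega

/-- Indices are bounded by the number of instructions, so the length of the extended program's code,
and with it the cost of pouring that code, is polynomial. -/
theorem WellFormed.length_encodeInstrs_le {L : List Instr} (hL : WellFormed L) :
    (encodeInstrs L).length ≤ L.length * (4 * L.length + 4) := by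
  have key : ∀ (X : ℕ) (L : List Instr), (∀ I ∈ L, I.fst ≤ X ∧ I.snd ≤ X) →
      (encodeInstrs L).length ≤ L.length * (4 * X + 4) := by
    intro X L
    induction L with
    | nil => simp
    | cons I L ih =>
      intro h
      have h1 := ih fun J hJ => h J (List.mem_cons_of_mem _ hJ)
      have h2 := h I List.mem_cons_self
      obtain ⟨o, j, k⟩ := I
      have h3 := length_encodeNat_le j
      have h4 := length_encodeNat_le k
      have h5 : (encodeOp o).length = 2 := by cases o <;> rfl
      simp only [encodeInstrs_cons, encodeInstr, List.length_append, List.length_cons, add_mul]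
      simp only at h2
      omega
  refine key _ _ fun I hI => ?_
  obtain ⟨k, hk, rfl⟩ := List.getElem_of_mem hI
  have := hL k hk
  omega

/-! #### The final questions -/

/-- Prepend the code of `4 a + 3` to `W`, where `a` is given on `B`. -/
def prepend : Cmd oracles Reg :=
  .push .W false ⨾ .loop .B nonempty (.ite .B topOne (.pop .B ⨾ .push .W true ⨾ .push .W true)
      (.pop .B ⨾ .push .W false ⨾ .push .W true)) ⨾
    .push .W true ⨾ .push .W true ⨾ .push .W true ⨾ .push .W true

theorem exec_prepend (v : ℕ) (w r i m c t a : List Bool) :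
    Exec prepend ⟨w, r, i, m, c, t, a, v.bits.reverse⟩ (5 * v.bits.length + 6)
      ⟨encodeNat (4 * v + 3) ++ w, r, i, m, c, t, a, []⟩ := by
  have key : ∀ l w : List Bool, Exec (.loop .B nonempty (.ite .B topOne
      (.pop .B ⨾ .push .W true ⨾ .push .W true) (.pop .B ⨾ .push .W false ⨾ .push .W true)))
      ⟨w, r, i, m, c, t, a, l⟩ (5 * l.length + 1) ⟨pairs l.reverse ++ w, r, i, m, c, t, a, []⟩ := by
    intro l
    induction l with
    | nil => exact fun w => Exec.loop_false rfl
    | cons d l ih =>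
      intro w
      have h : Exec (.ite .B topOne (.pop .B ⨾ .push .W true ⨾ .push .W true)
          (.pop .B ⨾ .push .W false ⨾ .push .W true)) ⟨w, r, i, m, c, t, a, d :: l⟩ 4
          ⟨true :: d :: w, r, i, m, c, t, a, l⟩ := by
        cases d
        · exact Exec.ite_false rfl ((Exec.pop .B _).seq ((Exec.push .W false _).seq
            (Exec.push .W true _)))
        · exact Exec.ite_true rfl ((Exec.pop .B _).seq ((Exec.push .W true _).seq
            (Exec.push .W true _)))
      refine cast ?_ ((Exec.loop_true rfl h (ih (true :: d :: w))).mono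
        (show _ ≤ 5 * (l.length + 1) + 1 by omega))
      simp [pairs_append]
  have e : (4 * v + 3).bits = true :: true :: v.bits := by
    rw [show 4 * v + 3 = 2 * (2 * v + 1) + 1 by ring, Nat.bit1_bits, Nat.bit1_bits]
  have h := key v.bits.reverse (false :: w)
  rw [List.reverse_reverse, List.length_reverse] at h
  rw [encodeNat_eq, e, List.append_assoc]
  refine ((Exec.push .W false _).seq (h.seq ((Exec.push .W true _).seq ((Exec.push .W true _).seq
    ((Exec.push .W true _).seq (Exec.push .W true _)))))).mono (by omega)

/-- Ask whether the number represented by `W` is positive and not divisible by `2 ^ (4 a + 3)`, where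
`a` is given on `B`, and write `1` to `T` if so. -/
def judge : Cmd oracles Reg :=
  .ask pos .W (prepend ⨾ .ask div2 .W .skip (.push .T true)) .skip

theorem exec_judge {L : List Instr} (hL : WellFormed L) (v : ℕ) (r i m c a : List Bool) :
    ∃ s : Mem, Exec judge ⟨encodeInstrs L, r, i, m, c, [], a, v.bits.reverse⟩
        (5 * v.bits.length + 9) s ∧
      (s.t.head? = some true ↔ 0 < (values L).getD L.length 0 ∧
        ¬ (2 : ℤ) ^ (4 * v + 3) ∣ (values L).getD L.length 0) := by
  by_cases hp : 0 < (values L).getD L.length 0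
  · by_cases hd : (2 : ℤ) ^ (4 * v + 3) ∣ (values L).getD L.length 0
    · refine ⟨_, (Exec.ask_true ((encodeInstrs_mem_PosSLP hL).mpr hp)
        ((exec_prepend v _ r i m c [] a).seq (Exec.ask_true
          ((encodeNat_append_mem_Div2SLP hL _).mpr hd) (Exec.skip _)))).mono (by omega), ?_⟩
      exact ⟨fun h => by simp at h, fun h => absurd hd h.2⟩
    · refine ⟨_, (Exec.ask_true ((encodeInstrs_mem_PosSLP hL).mpr hp)
        ((exec_prepend v _ r i m c [] a).seq (Exec.ask_false
          (fun h => hd ((encodeNat_append_mem_Div2SLP hL _).mp h)) (Exec.push .T true _)))).mono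
          (by omega), ?_⟩
      exact ⟨fun _ => ⟨hp, hd⟩, fun _ => rfl⟩
  · refine ⟨_, (Exec.ask_false (fun h => hp ((encodeInstrs_mem_PosSLP hL).mp h))
      (Exec.skip _)).mono (by omega), ?_⟩
    exact ⟨fun h => by simp at h, fun h => absurd h.1 hp⟩

theorem exec_pour_R_W (x i m c t a b : List Bool) :
    Exec (pour .R .W) ⟨[], x.reverse, i, m, c, t, a, b⟩ (4 * x.length + 1)
      ⟨x, [], i, m, c, t, a, b⟩ := by
  have := Exec.pour (k := .R) (l := .W) (x := x.reverse) (s := ⟨[], x.reverse, i, m, c, t, a, b⟩)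
    (by decide) rfl
  simpa [Mem.set, Mem.get] using this

theorem exec_pour_W_R (x i m c t a b : List Bool) :
    Exec (pour .W .R) ⟨x, [], i, m, c, t, a, b⟩ (4 * x.length + 1)
      ⟨[], x.reverse, i, m, c, t, a, b⟩ := by
  have := Exec.pour (k := .W) (l := .R) (x := x) (s := ⟨x, [], i, m, c, t, a, b⟩) (by decide) rfl
  simpa [Mem.set, Mem.get] using this

/-! ### The complete procedure and its running time -/

/-- The decision procedure for sums of three squares on well-formed inputs. -/
def decideValid : Cmd oracles Reg :=
  parse ⨾ pour .R .W ⨾ .push .W false ⨾ search ⨾ extract ⨾ pour .W .R ⨾ start ⨾ horner ⨾ combine ⨾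
    pour .R .W ⨾ judge

theorem exec_decideValid {L : List Instr} (hL : WellFormed L) :
    ∃ s : Mem, Exec decideValid ⟨encodeInstrs L, [], [], [], [], [], [], []⟩
        (4000 * ((encodeInstrs L).length + 1) ^ 2) s ∧
      (s.t.head? = some true ↔ encodeInstrs L ∈ ThreeSoSSLP) := by
  obtain ⟨n, hn⟩ : ∃ n, (encodeInstrs L).length = n := ⟨_, rfl⟩
  obtain ⟨m, hm⟩ : ∃ m, L.length = m := ⟨_, rfl⟩
  obtain ⟨N, hN⟩ : ∃ N, (values L).getD L.length 0 = N := ⟨_, rfl⟩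
  have hmn : m ≤ n := by rw [← hm, ← hn]; exact length_le_length_encodeInstrs L
  -- The invariant of the search at u = 0 and c = m: no nonzero value of the program is divisible by
  -- 4^(2^m), which exceeds 2^(2^m).
  have hbound : N ≠ 0 → ¬ (4 : ℤ) ^ ((0 + 1) * 2 ^ m) ∣ N := by
    intro h0 hdvd
    have h1 : |N| ≤ 2 ^ 2 ^ m := by
      rw [← hN, ← hm, List.getD_eq_getElem _ _ (by rw [length_values]; omega)]
      exact abs_le_of_mem_values L _ (List.getElem_mem _)
    have h2 := Int.le_of_dvd (abs_pos.mpr h0) ((dvd_abs _ _).mpr hdvd)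
    have h3 : (2 : ℤ) ^ 2 ^ m < 4 ^ ((0 + 1) * 2 ^ m) := by
      rw [zero_add, one_mul]
      exact pow_lt_pow_left₀ (by norm_num) (by norm_num) (by positivity)
    linarith
  have r1 := exec_parse L n [] [] [] [] 0 (by omega)
  simp only [List.append_nil, zero_add, Nat.zero_bits, hm, hn] at r1
  obtain ⟨v, hv1, hv2, hv3, r4⟩ := exec_search hL hN [] m.bits m.bits [] [] n m 0 hmn (by simp)
    hbound
  simp only [Nat.zero_bits, List.length_nil, zero_add] at hv3
  have r5 := exec_extract v (encodeInstrs L) [] m.bits m.bits [] []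
  have r2 := exec_pour_R_W (encodeInstrs L) m.bits m.bits (List.replicate m true) [] [] []
  have r6 := exec_pour_W_R (encodeInstrs L) m.bits m.bits [] [] v.bits.reverse v.bits.reverse
  have r7 := exec_start L m [] m.bits [] v.bits.reverse v.bits.reverse
  have hC : Computes L m N m N := ⟨hL, hm, by rw [← hm, hN], le_rfl, by rw [← hm, hN]⟩
  have hC1 : Computes (L ++ [⟨.mul, 0, 0⟩]) (m + 1) (4 ^ 0) m N := by
    have := hC.concat ⟨.mul, 0, 0⟩ (Nat.zero_le _) (Nat.zero_le _)
    simpa only [getD_values_zero, Op.eval, mul_one, pow_zero] using this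
  -- The bound 4n + 1 allows for m ≤ n input instructions, one for the initial 4^0, and three for
  -- each of at most m digits.
  obtain ⟨L', i, hC2, hi, r8⟩ := exec_horner (4 * n + 1) [] m.bits [] v.bits.reverse v.bits.reverse
    _ _ _ hC1 (by rw [List.length_reverse]; omega)
  rw [List.foldl_reverse, foldr_bit_bits] at hC2
  have r9 := exec_combine L' i m [] [] [] v.bits.reverse
  have hC3 := hC2.combine
  obtain ⟨L₂, hL₂⟩ : ∃ L₂, L' ++ [⟨.add, m, i⟩] ++ [⟨.mul, i, i + 1⟩] = L₂ := ⟨_, rfl⟩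
  rw [hL₂] at r9 hC3
  have r10 := exec_pour_R_W (encodeInstrs L₂) (i + 1).bits m.bits [] [] [] v.bits.reverse
  have hlen := hC3.wf.length_encodeInstrs_le
  obtain ⟨s, r11, hs⟩ := exec_judge hC3.wf v [] (i + 1).bits m.bits [] []
  -- The letter 0 pushed before the search is the code of u = 0.
  refine ⟨s, (r1.seq (r2.seq ((Exec.push .W false _).seq (r4.seq (r5.seq (r6.seq (r7.seq (r8.seq
    (r9.seq (r10.seq r11)))))))))).mono ?_, ?_⟩
  · rw [hC3.length_eq] at hlen
    rw [List.length_reverse, hn]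
    have b1 : m * (12 * n + 20) ≤ n * (12 * n + 20) := Nat.mul_le_mul_right _ hmn
    have b2 : m * (10 * n + 15) ≤ n * (10 * n + 15) := Nat.mul_le_mul_right _ hmn
    have b3 : v.bits.length * (78 * (4 * n + 1) + 50) ≤ n * (78 * (4 * n + 1) + 50) :=
      Nat.mul_le_mul_right _ (hv3.trans hmn)
    have b4 : (i + 2) * (4 * (i + 2) + 4) ≤ (4 * n + 3) * (4 * (4 * n + 3) + 4) :=
      Nat.mul_le_mul (by omega) (by omega)
    ring_nf at b1 b2 b3 b4 hlen ⊢
    omega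
  · rw [hs, hC3.length_eq, hC3.last, encodeInstrs_mem_ThreeSoSSLP hL, hN,
      sum_three_sq_iff_of_four_pow hv1 hv2]

/-- The decision procedure for sums of three squares. -/
def decideThreeSoS : Cmd oracles Reg :=
  .push .W false ⨾ .ask div2 .W (.pop .W ⨾ decideValid) .skip

theorem exec_decideThreeSoS (w : List Bool) :
    ∃ s : Mem, Exec decideThreeSoS ⟨w, [], [], [], [], [], [], []⟩ (4000 * (w.length + 1) ^ 2 + 3) s ∧
      (s.t.head? = some true ↔ w ∈ ThreeSoSSLP) := by
  by_cases h : false :: w ∈ Div2SLP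
  · obtain ⟨L, hL, rfl⟩ := false_cons_mem_Div2SLP.mp h
    obtain ⟨s, hs, ht⟩ := exec_decideValid hL
    exact ⟨s, ((Exec.push .W false ⟨encodeInstrs L, [], [], [], [], [], [], []⟩).seq
      (Exec.ask_true h ((Exec.pop .W _).seq hs))).mono (by omega), ht⟩
  · refine ⟨_, ((Exec.push .W false ⟨w, [], [], [], [], [], [], []⟩).seq
      (Exec.ask_false h (Exec.skip _))).mono (by omega), ⟨fun h' => ?_, fun h' => ?_⟩⟩
    · simp [Mem.set] at h'
    · exact absurd (false_cons_mem_Div2SLP.mpr (exists_wellFormed_of_mem_ThreeSoSSLP h')) h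

end ThreeSquaresProgram

end SLPComplexity

theorem theorem1p6 :
    SLPComplexity.ThreeSoSSLP ∈
      SLPComplexity.PolyTimeRel {SLPComplexity.Div2SLP, SLPComplexity.PosSLP} := by
  refine ⟨SLPComplexity.decideThreeSoS.toMachine .W .T,
    Polynomial.C 4000 * (Polynomial.X + 1) ^ 2 + Polynomial.C 4, fun w => ?_⟩
  obtain ⟨s, hs, ht⟩ := SLPComplexity.exec_decideThreeSoS w
  have e : (fun k => if k = SLPComplexity.Reg.W then w else []) = SLPComplexity.Mem.get ⟨w, [], [], [], [], [], [], []⟩ := by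
    funext k
    cases k <;> rfl
  rw [SLPComplexity.Exec, ← e] at hs
  have h := SLPComplexity.Cmd.Runs.decidesInTime (input := SLPComplexity.Reg.W) (output := SLPComplexity.Reg.T) (c := SLPComplexity.decideThreeSoS)
    hs ht
  convert h using 1
  simp
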